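/- **Setting.** Let $(\mathbb M,g)$ be a smooth $d$-dimensional ($d\ge 1$) Lorentzian manifold of signature $(1,-1,\dots,-1)$ (nonempty, Hausdorff, second countable) with a diffeomorphism $\mathbb M\cong\mathbb R\times\Sigma$ whose first component $t$ satisfies $dt(v)\neq0$ for every causal vector $v\ne0$; $t$ fixes the time orientation. Write $x\le y$ if $x=y$ or there is a piecewise smooth future-directed causal curve from $x$ to $y$; put $J^\pm(A)=\{y:\ \exists x\in A,\ x\le y\ (\text{resp. } y\le x)\}$ and $x\perp y$ if neither $x\le y$ nor $y\le x$. Assume that $(\mathbb M,g)$ is globally hyperbolic, i.e. all sets $\{z: x\le z\le y\}$ are compact. Let $dx$ be the volume measure of $g$, $\Box$ its d'Alembertian, $m>0$, $\mathcal D=C_0^\infty(\mathbb M,\mathbb C)$, and let $\mathcal G^\uparrow(\mathbb M,g)$ be the group of isometric diffeomorphisms preserving the time orientation; $f_\alpha=f\circ\alpha^{-1}$. A distribution $T$ on $\mathbb M\times\mathbb M$ (a separately continuous bilinear form on $\mathcal D$) is below given by locally integrable functions $T(f,\cdot)$: $T(f,h)=\int T(f,y)h(y)\,dy$. Let $G_{\rm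 r},G_{\rm a}$ be the retarded and advanced fundamental solutions: real distributions with $G_{\rm r/a}(f,\cdot)$ smooth, $G_{\rm r/a}((\Box+m^2)f,h)=G_{\rm r/a}(f,(\Box+m^2)h)=\int fh\,dx$ and $\operatorname{supp}G_{\rm r/a}(f,\cdot)\subseteq J^{\mp}(\operatorname{supp}f)$. Put $D=G_{\rm r}-G_{\rm a}$. Let $D^+$ be a complex distribution on $\mathbb M\times \mathbb M$, with $D^+(f,\cdot)$ measurable, and put $D^-(f,y)=\overline{D^+(\bar f,y)}$; assume that $D^+((\Box+m^2)f,h)=D^+(f,(\Box+m^2)h)=0$, $\operatorname{Im}D^+:=\frac1{2i}(D^+-D^-)=D$, $D^-(f,h)=D^+(h,f)$, $D^+(f_\alpha,h_\alpha)=D^+(f,h)$ for $\alpha\in\mathcal G^\uparrow(\mathbb M,g)$, and $D^+(\bar f,f)\ge0$, for all $f,h\in\mathcal D$. Let $b>0$ and $b_n\in\mathbb R$ $(n\ge3)$. Assume for every $n\ge3$ with $b_n\ne0$ the $n$-point dispersion condition: (i) $\int|D^+(f,x)|^n\,dx<\infty$ for all $f\in\mathcal D$; (ii) if $f_l\to0$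 in $\mathcal D$, then $D^+(f_l,x)\to0$ for all $x$, and there is a measurable $F$ with $F(x)\ge|D^+(f_l,x)|$ for all $x,l$ and $\int F(x)|D^+(f,x)|^{n-1}dx<\infty$ for all $f\in\mathcal D$. Define the truncated Wightman functions by $W_1^T=0$, $W_2^T(f_1,f_2)=\frac{b^2}{m^2}D^+(f_1,f_2)$ and, for $n\ge3$, $$W_n^T(f_1,\dots,f_n)=b_n\sum_{k=1}^n\int_{\mathbb M}\prod_{l=1}^{k-1}D^-(f_l,y)\;G_{\rm r}(f_k,y)\prod_{l=k+1}^nD^+(f_l,y)\,dy ,$$ and the Wightman functions by $W_n(f_1,\dots,f_n)=\sum_{I}\prod_{\{j_1<\dots<j_l\}\in I}W^T_l(f_{j_1},\dots,f_{j_l})$, the sum running over all partitions $I$ of $\{1,\dots,n\}$ into nonempty subsets (so $W_0=1$). **Theorem 4.1.** For every $n\ge3$ with $b_n\neq0$ all integrals above converge absolutely. Both the truncated and the full Wightman functions, $V_n=W_n^T$ and $V_n=W_n$, satisfy for all $n$ and all $f_1,\dots,f_n\in\mathcal D$: 1. (Hermiticity) $V_n(f_1,\dots,f_n)=\overline{V_n(\bar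 f_n,\dots,\bar f_1)}$; 2. (Invariance) $V_n(f_{1,\alpha},\dots,f_{n,\alpha})=V_n(f_1,\dots,f_n)$ for all $\alpha\in\mathcal G^\uparrow(\mathbb M,g)$; 3. (Locality) if $1\le k<n$ and $x\perp y$ for all $x\in\operatorname{supp}f_k$, $y\in\operatorname{supp}f_{k+1}$, then $$V_n(f_1,\dots,f_k,f_{k+1},\dots,f_n)-V_n(f_1,\dots,f_{k+1},f_k,\dots,f_n)=0 .$$ -/

import Mathlib

open scoped Manifold ContDiff

namespace CurvedQFT

open MeasureTheory Set Filter Topology Bundle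

noncomputable section

/-- The coordinate space of a `(n + 1)`-dimensional space-time. -/
abbrev Coord (n : ℕ) : Type := EuclideanSpace ℝ (Fin (n + 1))

section Geometry

variable {n : ℕ} {M : Type*} [TopologicalSpace M] [ChartedSpace (Coord n) M]

/-- A smooth Lorentzian metric of signature `(1, -1, …, -1)` on an `(n + 1)`-dimensional
manifold. -/
structure LorentzMetric (n : ℕ) (M : Type*) [TopologicalSpace M] [ChartedSpace (Coord n) M]
    [IsManifold (𝓡 (n + 1)) ∞ M] where
  /-- the bilinear form on each tangent space -/
  inner (x : M) : TangentSpace (𝓡 (n + 1)) x →L[ℝ] TangentSpace (𝓡 (n + 1)) x →L[ℝ] ℝ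
  symm (x : M) (v w : TangentSpace (𝓡 (n + 1)) x) : inner x v w = inner x w v
  signature (x : M) : ∃ e : Module.Basis (Fin (n + 1)) ℝ (TangentSpace (𝓡 (n + 1)) x),
    ∀ i j, inner x (e i) (e j) = if i = j then (if i = 0 then 1 else -1) else 0
  contMDiff : ContMDiff (𝓡 (n + 1)) ((𝓡 (n + 1)).prod 𝓘(ℝ, Coord n →L[ℝ] Coord n →L[ℝ] ℝ)) ∞
    (fun x ↦ TotalSpace.mk' (Coord n →L[ℝ] Coord n →L[ℝ] ℝ)
      (E := fun x : M ↦ TangentSpace (𝓡 (n + 1)) x →L[ℝ] TangentSpace (𝓡 (n + 1)) x →L[ℝ] ℝ)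
      x (inner x))

variable [IsManifold (𝓡 (n + 1)) ∞ M]

/-! ### Volume and d'Alembertian -/

/-- The vector of the `i`-th coordinate direction of the chart at `p`, at the point with
coordinates `y`. -/
def coordVec (p : M) (y : Coord n) (i : Fin (n + 1)) :
    TangentSpace (𝓡 (n + 1)) ((chartAt (Coord n) p).symm y) :=
  mfderiv (𝓡 (n + 1)) (𝓡 (n + 1)) (chartAt (Coord n) p).symm y
    (EuclideanSpace.single i (1 : ℝ) : Coord n)

/-- The matrix `g_{ij}` of the metric in the chart at `p`, as a function of the coordinates. -/
def gram (g : LorentzMetric n M) (p : M) (y : Coord n) : Matrix (Fin (n + 1)) (Fin (n + 1)) ℝ :=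
  Matrix.of fun i j ↦ g.inner ((chartAt (Coord n) p).symm y) (coordVec p y i) (coordVec p y j)

/-- The density `|det g|^{1/2}` in the chart at `p`. -/
def density (g : LorentzMetric n M) (p : M) (y : Coord n) : ℝ :=
  Real.sqrt |(gram g p y).det|

/-- The partial derivative `∂_i` of a complex function of the coordinates. -/
def partialDeriv (i : Fin (n + 1)) (u : Coord n → ℂ) (y : Coord n) : ℂ :=
  fderiv ℝ u y (EuclideanSpace.single i (1 : ℝ))

/-- The d'Alembertian `□ f = |det g|^{-1/2} ∂_i (|det g|^{1/2} g^{ij} ∂_j f)`, evaluated at `x` in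
the preferred chart at `x`. -/
def dAlembertian (g : LorentzMetric n M) (f : M → ℂ) (x : M) : ℂ :=
  let y₀ : Coord n := chartAt (Coord n) x x
  ((density g x y₀ : ℝ) : ℂ)⁻¹ * ∑ i, partialDeriv i (fun y ↦ ∑ j,
    ((density g x y * (gram g x y)⁻¹ i j : ℝ) : ℂ) *
      partialDeriv j (f ∘ (chartAt (Coord n) x).symm) y) y₀

/-- The Klein-Gordon operator `□ + m²`. -/
def kleinGordon (g : LorentzMetric n M) (m : ℝ) (f : M → ℂ) (x : M) : ℂ :=
  dAlembertian g f x + (m : ℂ) ^ 2 * f x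

/-- The measure `|det g|^{1/2} dy` on the domain of the chart at `p`, transported to `M`. -/
def chartVolume [MeasurableSpace M] (g : LorentzMetric n M) (p : M) : Measure M :=
  (((volume : Measure (Coord n)).restrict (chartAt (Coord n) p).target).withDensity
    (fun y ↦ ENNReal.ofReal (density g p y))).map (chartAt (Coord n) p).symm

/-- Countably many chart domains cover a second countable manifold. -/
theorem exists_coverSeq (n : ℕ) (M : Type*) [TopologicalSpace M] [ChartedSpace (Coord n) M]
    [SecondCountableTopology M] [Nonempty M] :
    ∃ e : ℕ → M, ⋃ k, (chartAt (Coord n) (e k)).source = univ := by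
  obtain ⟨s, hs, hcov⟩ := TopologicalSpace.countable_cover_nhds
    (f := fun x : M ↦ (chartAt (Coord n) x).source) (fun x ↦ chart_source_mem_nhds (Coord n) x)
  have hne : s.Nonempty := by
    by_contra h
    rw [not_nonempty_iff_eq_empty] at h
    simp [h] at hcov
    exact (empty_ne_univ hcov).elim
  obtain ⟨e, he⟩ := hs.exists_eq_range hne
  refine ⟨e, ?_⟩
  rw [← hcov, he, biUnion_range]

/-- A sequence of points whose chart domains cover the manifold. -/
def coverSeq (n : ℕ) (M : Type*) [TopologicalSpace M] [ChartedSpace (Coord n) M]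
    [SecondCountableTopology M] [Nonempty M] : ℕ → M :=
  (exists_coverSeq n M).choose

/-- The canonical volume measure `dx` of `g`: the chart volumes, glued along a countable cover by
chart domains that is made disjoint. -/
def volumeMeasure [SecondCountableTopology M] [Nonempty M] [MeasurableSpace M]
    (g : LorentzMetric n M) : Measure M :=
  Measure.sum fun k ↦ (chartVolume g (coverSeq n M k)).restrict
    (disjointed (fun k ↦ (chartAt (Coord n) (coverSeq n M k)).source) k)

/-! ### Causal structure -/

/-- The time coordinate given by a splitting `M ≅ ℝ × S`. -/
def timeOf {S : Type*} [TopologicalSpace S] [ChartedSpace (EuclideanSpace ℝ (Fin n)) S]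
    (Φ : M ≃ₘ^∞⟮𝓡 (n + 1), (𝓘(ℝ, ℝ)).prod (𝓡 n)⟯ (ℝ × S)) (x : M) : ℝ := (Φ x).1

/-- The differential `dt(v)` of a function on `M`. -/
def dTime (t : M → ℝ) (x : M) (v : TangentSpace (𝓡 (n + 1)) x) : ℝ :=
  mfderiv (𝓡 (n + 1)) 𝓘(ℝ, ℝ) t x v

/-- Future-directed causal (time-like or light-like, nonzero) tangent vectors, the time direction
being that of increasing `t`. -/
def FutureCausal (g : LorentzMetric n M) (t : M → ℝ) (x : M)
    (v : TangentSpace (𝓡 (n + 1)) x) : Prop :=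
  0 ≤ g.inner x v v ∧ 0 < dTime t x v

/-- There is a smooth future-directed causal curve `[0,1] → M` from `x` to `y`. -/
def CausalStep (g : LorentzMetric n M) (t : M → ℝ) (x y : M) : Prop :=
  ∃ γ : ℝ → M, ContMDiff 𝓘(ℝ, ℝ) (𝓡 (n + 1)) ∞ γ ∧ γ 0 = x ∧ γ 1 = y ∧
    ∀ s ∈ Icc (0 : ℝ) 1, FutureCausal g t (γ s) (mfderiv 𝓘(ℝ, ℝ) (𝓡 (n + 1)) γ s (1 : ℝ))

/-- The causal order: `x = y`, or there is a piecewise smooth future-directed causal curve from `x`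
to `y`. -/
def CausalLE (g : LorentzMetric n M) (t : M → ℝ) : M → M → Prop :=
  Relation.ReflTransGen (CausalStep g t)

/-- The causal future `⋃_{x ∈ A} V̄⁺_x` of a set. -/
def causalFuture (g : LorentzMetric n M) (t : M → ℝ) (A : Set M) : Set M :=
  {y | ∃ x ∈ A, CausalLE g t x y}

/-- The causal past `⋃_{x ∈ A} V̄⁻_x` of a set. -/
def causalPast (g : LorentzMetric n M) (t : M → ℝ) (A : Set M) : Set M :=
  {y | ∃ x ∈ A, CausalLE g t y x}

/-- `x ⊥ y`: distinct points not joined by a light-like, time-like or, equivalently, causal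
curve. -/
def Spacelike (g : LorentzMetric n M) (t : M → ℝ) (x y : M) : Prop :=
  ¬ CausalLE g t x y ∧ ¬ CausalLE g t y x

/-- The time coordinate `t` fixes a time orientation (`dt` vanishes on no nonzero causal vector, so
there are no closed causal curves), and all causal diamonds are compact. -/
structure IsGloballyHyperbolic (g : LorentzMetric n M) (t : M → ℝ) : Prop where
  temporal : ∀ (x : M) (v : TangentSpace (𝓡 (n + 1)) x), v ≠ 0 → 0 ≤ g.inner x v v →
    dTime t x v ≠ 0
  diamond : ∀ x y : M, IsCompact {z | CausalLE g t x z ∧ CausalLE g t z y}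

/-- Membership in the group of isometric diffeomorphisms that preserve the time orientation. -/
structure IsOrthochronousIsometry (g : LorentzMetric n M) (t : M → ℝ)
    (α : M ≃ₘ^∞⟮𝓡 (n + 1), 𝓡 (n + 1)⟯ M) : Prop where
  isometric : ∀ (x : M) (v w : TangentSpace (𝓡 (n + 1)) x),
    g.inner (α x) (mfderiv (𝓡 (n + 1)) (𝓡 (n + 1)) α x v)
      (mfderiv (𝓡 (n + 1)) (𝓡 (n + 1)) α x w) = g.inner x v w
  orientation : ∀ (x : M) (v : TangentSpace (𝓡 (n + 1)) x), FutureCausal g t x v →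
    FutureCausal g t (α x) (mfderiv (𝓡 (n + 1)) (𝓡 (n + 1)) α x v)

/-! ### Test functions and bidistributions -/

/-- The space `𝒟(M, ℂ)` of smooth compactly supported complex functions. -/
def IsTest (n : ℕ) {M : Type*} [TopologicalSpace M] [ChartedSpace (Coord n) M]
    (f : M → ℂ) : Prop :=
  ContMDiff (𝓡 (n + 1)) 𝓘(ℝ, ℂ) ∞ f ∧ HasCompactSupport f

/-- Convergence `u_l → 0` in `𝒟(M, ℂ)`: the supports stay in one compact set, and all derivatives
converge to zero uniformly on compact subsets of the charts. -/
def TendstoZeroTest (n : ℕ) {M : Type*} [TopologicalSpace M] [ChartedSpace (Coord n) M]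
    (u : ℕ → M → ℂ) : Prop :=
  (∀ l, IsTest n (u l)) ∧ (∃ K : Set M, IsCompact K ∧ ∀ l, tsupport (u l) ⊆ K) ∧
  ∀ (p : M) (C : Set (Coord n)), IsCompact C → C ⊆ (chartAt (Coord n) p).target → ∀ j : ℕ,
    TendstoUniformlyOn
      (fun l y ↦ iteratedFDeriv ℝ j (u l ∘ (chartAt (Coord n) p).symm) y) 0 atTop C

/-- Complex conjugation of functions. -/
def bar {X : Type*} (f : X → ℂ) (x : X) : ℂ := (starRingEnd ℂ) (f x)

/-- The pairing `T(f, h) = ∫ T(f, y) h(y) dy` for `T` given through the functions `T f = T(f, ·)`. -/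
def pair [MeasurableSpace M] (μ : Measure M) (T : (M → ℂ) → M → ℂ) (f h : M → ℂ) : ℂ :=
  ∫ y, T f y * h y ∂μ

/-- `T` is a distribution on `M × M`, i.e. a separately continuous bilinear form on test functions,
for which `T(f, ·)` is a locally integrable function. -/
structure IsBidistribution [MeasurableSpace M] (μ : Measure M)
    (T : (M → ℂ) → M → ℂ) : Prop where
  locallyIntegrable : ∀ f, IsTest n f → LocallyIntegrable (T f) μ
  add : ∀ f₁ f₂ h, IsTest n f₁ → IsTest n f₂ → IsTest n h →
    pair μ T (f₁ + f₂) h = pair μ T f₁ h + pair μ T f₂ h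
  smul : ∀ (c : ℂ) (f h), IsTest n f → IsTest n h → pair μ T (c • f) h = c * pair μ T f h
  continuous : ∀ (u : ℕ → M → ℂ) (h), TendstoZeroTest n u → IsTest n h →
    Tendsto (fun l ↦ pair μ T (u l) h) atTop (𝓝 0)

variable [SecondCountableTopology M] [Nonempty M] [MeasurableSpace M]

/-! ### Fundamental functions -/

/-- `G` is a real fundamental solution of `□ + m²`, with `G(f, ·)` smooth and supported in
`cone (supp f)`. -/
structure IsFundamentalSolution (g : LorentzMetric n M) (m : ℝ) (cone : Set M → Set M)
    (G : (M → ℂ) → M → ℂ) : Prop where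
  bidistribution : IsBidistribution (n := n) (volumeMeasure g) G
  smooth : ∀ f, IsTest n f → ContMDiff (𝓡 (n + 1)) 𝓘(ℝ, ℂ) ∞ (G f)
  real : ∀ f, IsTest n f → G (bar f) = bar (G f)
  left : ∀ f h, IsTest n f → IsTest n h →
    pair (volumeMeasure g) G (kleinGordon g m f) h = ∫ x, f x * h x ∂(volumeMeasure g)
  right : ∀ f h, IsTest n f → IsTest n h →
    pair (volumeMeasure g) G f (kleinGordon g m h) = ∫ x, f x * h x ∂(volumeMeasure g)
  support : ∀ f, IsTest n f → tsupport (G f) ⊆ cone (tsupport f)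

/-- The retarded fundamental solution `G_r`: `supp G_r(f, ·)` lies in the causal past of
`supp f`. -/
def IsRetarded (g : LorentzMetric n M) (t : M → ℝ) (m : ℝ) (G : (M → ℂ) → M → ℂ) : Prop :=
  IsFundamentalSolution g m (causalPast g t) G

/-- The advanced fundamental solution `G_a`: `supp G_a(f, ·)` lies in the causal future of
`supp f`. -/
def IsAdvanced (g : LorentzMetric n M) (t : M → ℝ) (m : ℝ) (G : (M → ℂ) → M → ℂ) : Prop :=
  IsFundamentalSolution g m (causalFuture g t) G

/-- The commutator function `D = G_r - G_a`. -/
def commutatorFn (Gr Ga : (M → ℂ) → M → ℂ) (f : M → ℂ) (y : M) : ℂ := Gr f y - Ga f y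

/-- The function `D⁻(f, y)`, the complex conjugate of `D⁺(f̄, y)`. -/
def minusFn (Dp : (M → ℂ) → M → ℂ) (f : M → ℂ) : M → ℂ := bar (Dp (bar f))

/-- The requirements on the two-point distribution `D⁺`. -/
structure IsTwoPoint (g : LorentzMetric n M) (t : M → ℝ) (m : ℝ)
    (Gr Ga Dp : (M → ℂ) → M → ℂ) : Prop where
  bidistribution : IsBidistribution (n := n) (volumeMeasure g) Dp
  measurable : ∀ f, IsTest n f → Measurable (Dp f)
  left : ∀ f h, IsTest n f → IsTest n h →
    pair (volumeMeasure g) Dp (kleinGordon g m f) h = 0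
  right : ∀ f h, IsTest n f → IsTest n h →
    pair (volumeMeasure g) Dp f (kleinGordon g m h) = 0
  /-- `Im D⁺ = D`, where `Im D⁺ = (D⁺ - D⁻) / 2i` -/
  imaginary : ∀ f h, IsTest n f → IsTest n h →
    pair (volumeMeasure g) Dp f h - pair (volumeMeasure g) (minusFn Dp) f h =
      2 * Complex.I * pair (volumeMeasure g) (commutatorFn Gr Ga) f h
  /-- `D⁻(f, h) = D⁺(h, f)` -/
  symmetric : ∀ f h, IsTest n f → IsTest n h →
    pair (volumeMeasure g) (minusFn Dp) f h = pair (volumeMeasure g) Dp h f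
  invariant : ∀ α : M ≃ₘ^∞⟮𝓡 (n + 1), 𝓡 (n + 1)⟯ M, IsOrthochronousIsometry g t α →
    ∀ f h, IsTest n f → IsTest n h →
      pair (volumeMeasure g) Dp (f ∘ α.symm) (h ∘ α.symm) = pair (volumeMeasure g) Dp f h
  positive : ∀ f, IsTest n f → 0 ≤ (pair (volumeMeasure g) Dp (bar f) f).re ∧
    (pair (volumeMeasure g) Dp (bar f) f).im = 0

/-- The `N`-point dispersion condition. -/
structure DispersionCondition (g : LorentzMetric n M) (Dp : (M → ℂ) → M → ℂ) (N : ℕ) : Prop where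
  integrable : ∀ f, IsTest n f → Integrable (fun x ↦ ‖Dp f x‖ ^ N) (volumeMeasure g)
  pointwise : ∀ u : ℕ → M → ℂ, TendstoZeroTest n u → ∀ x,
    Tendsto (fun l ↦ Dp (u l) x) atTop (𝓝 0)
  dominated : ∀ u : ℕ → M → ℂ, TendstoZeroTest n u → ∃ F : M → ℝ, Measurable F ∧
    (∀ l x, ‖Dp (u l) x‖ ≤ F x) ∧ ∀ f, IsTest n f →
      Integrable (fun x ↦ F x * ‖Dp f x‖ ^ (N - 1)) (volumeMeasure g)

/-! ### Wightman functions -/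

/-- The integrand `∏_{l<k} D⁻(f_l, y) · G_r(f_k, y) · ∏_{l>k} D⁺(f_l, y)`. -/
def vertexIntegrand (Gr Dp : (M → ℂ) → M → ℂ) {N : ℕ} (f : Fin N → M → ℂ) (k : Fin N)
    (y : M) : ℂ :=
  (∏ l ∈ Finset.Iio k, minusFn Dp (f l) y) * Gr (f k) y * ∏ l ∈ Finset.Ioi k, Dp (f l) y

/-- The truncated Wightman functions: the one-point function is zero, the two-point function is
`(b² / m²) D⁺`, and the `N`-point function for `N ≥ 3` is the sum of the vertex integrals. (The
value for `N = 0` is never used.) -/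
def truncatedWightman (g : LorentzMetric n M) (m b : ℝ) (bn : ℕ → ℝ)
    (Gr Dp : (M → ℂ) → M → ℂ) : (N : ℕ) → (Fin N → M → ℂ) → ℂ
  | 0, _ => 0
  | 1, _ => 0
  | 2, f => ((b ^ 2 / m ^ 2 : ℝ) : ℂ) * pair (volumeMeasure g) Dp (f 0) (f 1)
  | N + 3, f => (bn (N + 3) : ℂ) *
      ∑ k : Fin (N + 3), ∫ y, vertexIntegrand Gr Dp f k y ∂(volumeMeasure g)

/-- The Wightman functions obtained from truncated ones: the sum over all partitions of the index
set, the arguments in each block being kept in increasing order. -/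
def fromTruncated {M : Type*} (WT : (N : ℕ) → (Fin N → M → ℂ) → ℂ) (N : ℕ)
    (f : Fin N → M → ℂ) : ℂ :=
  ∑ I : Finpartition (Finset.univ : Finset (Fin N)),
    ∏ B ∈ I.parts, WT B.card (fun i ↦ f (B.orderEmbOfFin rfl i))

end Geometry

section Properties

/-- Hermiticity of a family of `N`-point functions. -/
def Hermitian (n : ℕ) {M : Type*} [TopologicalSpace M] [ChartedSpace (Coord n) M]
    (W : (N : ℕ) → (Fin N → M → ℂ) → ℂ) : Prop :=
  ∀ (N : ℕ) (f : Fin N → M → ℂ), (∀ i, IsTest n (f i)) →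
    W N f = (starRingEnd ℂ) (W N fun i ↦ bar (f i.rev))

/-- Invariance under the isometric diffeomorphisms that preserve the time orientation, acting by
`f_α = f ∘ α⁻¹`. -/
def Invariant {n : ℕ} {M : Type*} [TopologicalSpace M] [ChartedSpace (Coord n) M]
    [IsManifold (𝓡 (n + 1)) ∞ M] (g : LorentzMetric n M) (t : M → ℝ)
    (W : (N : ℕ) → (Fin N → M → ℂ) → ℂ) : Prop :=
  ∀ α : M ≃ₘ^∞⟮𝓡 (n + 1), 𝓡 (n + 1)⟯ M, IsOrthochronousIsometry g t α →
    ∀ (N : ℕ) (f : Fin N → M → ℂ), (∀ i, IsTest n (f i)) →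
      W N (fun i ↦ f i ∘ α.symm) = W N f

/-- Locality: the commutator of two neighbouring fields vanishes if the supports of their test
functions are space-like separated. -/
def Local {n : ℕ} {M : Type*} [TopologicalSpace M] [ChartedSpace (Coord n) M]
    [IsManifold (𝓡 (n + 1)) ∞ M] (g : LorentzMetric n M) (t : M → ℝ)
    (W : (N : ℕ) → (Fin N → M → ℂ) → ℂ) : Prop :=
  ∀ (N : ℕ) (f : Fin N → M → ℂ), (∀ i, IsTest n (f i)) → ∀ i j : Fin N, i.val + 1 = j.val →
    (∀ x ∈ tsupport (f i), ∀ y ∈ tsupport (f j), Spacelike g t x y) →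
      W N f - W N (f ∘ Equiv.swap i j) = 0

end Properties

end

end CurvedQFT

open scoped Manifold ContDiff

/-! The combinatorial passage from truncated to full functions is formal: a permutation of the
indices permutes the partitions, so each of the three properties only has to be compared block by
block (`Hermitian.fromTruncated`, `Invariant.fromTruncated`, `Local.fromTruncated`). The analysis
concerns the vertex integrals.

Convergence. The hypothesis `Im D⁺ = D`, read as an identity of functions, gives `D⁺ - D⁻ = 2i (G_r
- G_a)` almost everywhere (`IsTwoPoint.sub_minusFn_ae`). For a fixed test function, `G_r` and `G_a`
are both nonzero only in the intersection of the past and the future of a compact set, which global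
hyperbolicity makes relatively compact. Off this set `G_r`, where it does not vanish, is a multiple
of `D⁺ - D⁻`; on it `G_r` is bounded. Hence `G_r` inherits `L^N` integrability from `D⁺`
(`DispersionCondition.memLp_retarded`), and Hölder's inequality bounds a product of `N` factors.

Hermiticity. Conjugation exchanges `D⁺` and `D⁻`, and reversing the arguments exchanges the two
sides of the vertex.

Invariance. `D⁺` is invariant by assumption, whereas invariance of `G_r` has to be proved
(`retarded_comp`). Since `G_r - G_a` is determined by `D⁺`, the defects of invariance of `G_r` and
of `G_a` are the same function. It is therefore supported both in the past and in the future of a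
compact set; it is a compactly supported weak solution of the Klein-Gordon equation and so vanishes.
This needs the naturality under isometries of the d'Alembertian (by the Piola identity) and of the
volume (by change of variables).

Locality. Only the vertices at the two exchanged arguments matter. By the identity for `D⁺ - D⁻`
their contribution to the commutator reduces to products of `G_r` of one argument with `G_a` of the
other, which vanish for space-like separated supports (`vertexIntegrand_add_swap_ae`). -/

namespace CurvedQFT

set_option linter.unusedSectionVars false

open MeasureTheory Set Filter Topology Bundle

/-! ### Permutations acting on partitions of a finite set. -/

section Partitions

/-- The order isomorphism of the lattice of finite sets induced by a permutation. -/
def finsetMapIso {ι : Type*} (σ : Equiv.Perm ι) : Finset ι ≃o Finset ι where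
  toEquiv := σ.finsetCongr
  map_rel_iff' := by
    intro a b
    simp [Equiv.finsetCongr_apply]

theorem finsetMapIso_apply {ι : Type*} (σ : Equiv.Perm ι) (B : Finset ι) :
    finsetMapIso σ B = B.map σ.toEmbedding := rfl

/-- The image of a partition of a finite type under a permutation. -/
def permPartition {ι : Type*} [Fintype ι] [DecidableEq ι] (σ : Equiv.Perm ι)
    (I : Finpartition (Finset.univ : Finset ι)) : Finpartition (Finset.univ : Finset ι) :=
  (I.map (finsetMapIso σ)).copy (by simp [finsetMapIso_apply])

theorem parts_permPartition {ι : Type*} [Fintype ι] [DecidableEq ι] (σ : Equiv.Perm ι)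
    (I : Finpartition (Finset.univ : Finset ι)) :
    (permPartition σ I).parts = I.parts.map (finsetMapIso σ).toEquiv.toEmbedding := by
  exact Finpartition.parts_map

theorem permPartition_symm_apply {ι : Type*} [Fintype ι] [DecidableEq ι] (σ : Equiv.Perm ι)
    (I : Finpartition (Finset.univ : Finset ι)) :
    permPartition σ.symm (permPartition σ I) = I := by
  ext B
  simp only [parts_permPartition, Finset.mem_map, Equiv.coe_toEmbedding]
  constructor
  · rintro ⟨_, ⟨C, hC, rfl⟩, rfl⟩
    convert hC
    change Finset.map _ (Finset.map _ C) = C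
    ext x
    simp
  · intro h
    refine ⟨_, ⟨B, h, rfl⟩, ?_⟩
    change Finset.map _ (Finset.map _ B) = B
    ext x
    simp

/-- Sums over partitions are invariant under a permutation of the underlying set. -/
theorem sum_finpartition_perm {ι : Type*} [Fintype ι] [DecidableEq ι] (σ : Equiv.Perm ι)
    (φ : Finset ι → ℂ) :
    ∑ I : Finpartition (Finset.univ : Finset ι), ∏ B ∈ I.parts, φ (B.map σ.toEmbedding) =
      ∑ I : Finpartition (Finset.univ : Finset ι), ∏ B ∈ I.parts, φ B := by
  refine Finset.sum_nbij' (permPartition σ) (permPartition σ.symm) (by simp) (by simp)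
    (fun I _ ↦ permPartition_symm_apply σ I) (fun I _ ↦ permPartition_symm_apply σ.symm I) ?_
  intro I _
  rw [parts_permPartition, Finset.prod_map]
  rfl

variable {M : Type*}

/-- The number of arguments labelled by a block may be replaced by an equal number. -/
theorem block_eq (WT : (N : ℕ) → (Fin N → M → ℂ) → ℂ) {N : ℕ} (f : Fin N → M → ℂ)
    (B : Finset (Fin N)) {k : ℕ} (h : B.card = k) :
    WT B.card (fun i ↦ f (B.orderEmbOfFin rfl i)) = WT k (fun i ↦ f (B.orderEmbOfFin h i)) := by
  subst h
  rfl

end Partitions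

/-! ### From truncated to full Wightman functions. -/

variable {n : ℕ} {M : Type*} [TopologicalSpace M] [ChartedSpace (Coord n) M]

theorem isTest_bar {f : M → ℂ} (hf : IsTest n f) : IsTest n (bar f) := by
  refine ⟨?_, ?_⟩
  · exact Complex.conjCLE.contDiff.contMDiff.comp hf.1
  · exact hf.2.comp_left (g := starRingEnd ℂ) (map_zero _)

theorem bar_bar {X : Type*} (f : X → ℂ) : bar (bar f) = f := by
  funext x
  simp [bar]

/-- Reindexing the sum by the reversal of indices pairs each block with its mirror image. The
increasing enumeration of the mirror image is the reversed enumeration of the block, by uniqueness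
of increasing enumerations, so hermiticity applies to each factor. -/
theorem Hermitian.fromTruncated {WT : (N : ℕ) → (Fin N → M → ℂ) → ℂ} (h : Hermitian n WT) :
    Hermitian n (fromTruncated WT) := by
  intro N f hf
  unfold CurvedQFT.fromTruncated
  rw [← sum_finpartition_perm Fin.revPerm, map_sum]
  refine Finset.sum_congr rfl fun I _ ↦ ?_
  rw [map_prod]
  refine Finset.prod_congr rfl fun B _ ↦ ?_
  rw [block_eq WT f _ (Finset.card_map Fin.revPerm.toEmbedding), h _ _ fun i ↦ hf _]
  congr 2
  funext i
  congr 2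
  have : StrictMono fun i : Fin B.card ↦ (B.orderEmbOfFin rfl i.rev).rev := by
    intro a b hab
    simpa using hab
  rw [← congrFun (Finset.orderEmbOfFin_unique (Finset.card_map Fin.revPerm.toEmbedding) ?_ this)]
  · simp
  · intro x
    simp

variable [IsManifold (𝓡 (n + 1)) ∞ M] {g : LorentzMetric n M} {t : M → ℝ}

theorem Invariant.fromTruncated {WT : (N : ℕ) → (Fin N → M → ℂ) → ℂ} (h : Invariant g t WT) :
    Invariant g t (fromTruncated WT) := by
  intro α hα N f hf
  unfold CurvedQFT.fromTruncated
  refine Finset.sum_congr rfl fun I _ ↦ Finset.prod_congr rfl fun B _ ↦ ?_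
  exact h α hα _ (fun i ↦ f (B.orderEmbOfFin rfl i)) fun i ↦ hf _

/-- Reindexing by the transposition pairs a block `B` with its image. If `B` contains both indices
it is its own image, and they are neighbours within it, so truncated locality applies. Otherwise the
two factors are equal without any locality. -/
theorem Local.fromTruncated {WT : (N : ℕ) → (Fin N → M → ℂ) → ℂ} (h : Local g t WT) :
    Local g t (fromTruncated WT) := by
  intro N f hf i j hij hsp
  rw [sub_eq_zero]
  unfold CurvedQFT.fromTruncated
  rw [← sum_finpartition_perm (Equiv.swap i j)]
  refine Finset.sum_congr rfl fun I _ ↦ Finset.prod_congr rfl fun B _ ↦ ?_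
  by_cases hB : i ∈ B ∧ j ∈ B
  · have hmap : B.map (Equiv.swap i j).toEmbedding = B := by
      ext x
      simp only [Finset.mem_map_equiv, Equiv.symm_swap, Equiv.swap_apply_def]
      split_ifs with h1 h2
      · simp [h1, hB]
      · simp [h2, hB]
      · rfl
    rw [hmap]
    obtain ⟨a, ha⟩ : ∃ a, B.orderEmbOfFin rfl a = i := by
      have : i ∈ Set.range (B.orderEmbOfFin rfl) := by simpa using hB.1
      exact this
    obtain ⟨b, hb⟩ : ∃ b, B.orderEmbOfFin rfl b = j := by
      have : j ∈ Set.range (B.orderEmbOfFin rfl) := by simpa using hB.2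
      exact this
    -- No index lies strictly between `i` and `j = i + 1`, so none does inside the block either.
    have hab : a.val + 1 = b.val := by
      have h1 : a < b := by
        rw [← (B.orderEmbOfFin rfl).lt_iff_lt, ha, hb, Fin.lt_def]
        omega
      by_contra hne
      have h2 : a.val + 1 < B.card := by
        have := b.2
        omega
      have h3 : a < ⟨a.val + 1, h2⟩ := by simp [Fin.lt_def]
      have h4 : (⟨a.val + 1, h2⟩ : Fin B.card) < b := by
        rw [Fin.lt_def] at h1 ⊢
        simp only
        omega
      rw [← (B.orderEmbOfFin rfl).lt_iff_lt, Fin.lt_def, ha] at h3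
      rw [← (B.orderEmbOfFin rfl).lt_iff_lt, Fin.lt_def, hb] at h4
      omega
    have key := h _ (fun k ↦ f (B.orderEmbOfFin rfl k)) (fun k ↦ hf _) a b hab
      (by simpa only [ha, hb] using hsp)
    rw [sub_eq_zero] at key
    rw [key]
    congr 1
    funext k
    simp only [Function.comp_apply]
    rw [(B.orderEmbOfFin rfl).injective.map_swap, ha, hb]
  · rw [block_eq WT f _ (Finset.card_map (Equiv.swap i j).toEmbedding)]
    congr 1
    funext k
    simp only [Function.comp_apply]
    congr 1
    -- Exchanging two adjacent integers reverses the order of that pair only, and the block does not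
    -- contain the pair.
    have : StrictMono fun k : Fin B.card ↦ Equiv.swap i j (B.orderEmbOfFin rfl k) := by
      intro a b hab
      rw [← (B.orderEmbOfFin rfl).lt_iff_lt] at hab
      change Equiv.swap i j (B.orderEmbOfFin rfl a) < Equiv.swap i j (B.orderEmbOfFin rfl b)
      have ha := B.orderEmbOfFin_mem rfl a
      have hb := B.orderEmbOfFin_mem rfl b
      generalize B.orderEmbOfFin rfl a = x at *
      generalize B.orderEmbOfFin rfl b = y at *
      have hxy : ¬ (x = i ∧ y = j) := by
        rintro ⟨rfl, rfl⟩
        exact hB ⟨ha, hb⟩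
      simp only [Equiv.swap_apply_def, Fin.ext_iff, Fin.lt_def] at hab hxy ⊢
      split_ifs <;> omega
    rw [← Finset.orderEmbOfFin_unique (Finset.card_map (Equiv.swap i j).toEmbedding) ?_ this]
    intro x
    simp

/-! ### Determinants and inverses of matrix-valued functions -/

section Matrix

variable {ι : Type*} [Fintype ι] [DecidableEq ι] {E : Type*} [NormedAddCommGroup E]
  [NormedSpace ℝ E] {k : WithTop ℕ∞} {x : E} {A : E → Matrix ι ι ℝ}

theorem contDiffAt_det (hA : ∀ i j, ContDiffAt ℝ k (fun y ↦ A y i j) x) :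
    ContDiffAt ℝ k (fun y ↦ (A y).det) x := by
  simp only [Matrix.det_apply']
  exact ContDiffAt.sum fun σ _ ↦ contDiffAt_const.mul (contDiffAt_prod fun i _ ↦ hA _ _)

theorem contDiffAt_matrixInv (hA : ∀ i j, ContDiffAt ℝ k (fun y ↦ A y i j) x)
    (hx : (A x).det ≠ 0) (i j : ι) : ContDiffAt ℝ k (fun y ↦ (A y)⁻¹ i j) x := by
  simp only [Matrix.inv_def, Matrix.smul_apply, Ring.inverse_eq_inv', smul_eq_mul,
    Matrix.adjugate_apply]
  refine ((contDiffAt_det hA).inv hx).mul (contDiffAt_det fun a b ↦ ?_)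
  by_cases h : a = j
  · subst h
    simpa using contDiffAt_const
  · simpa [Matrix.updateRow_apply, h] using hA a b

theorem contDiffAt_sqrt_abs_det {k : ℕ∞} (hA : ∀ i j, ContDiffAt ℝ k (fun y ↦ A y i j) x)
    (hx : (A x).det ≠ 0) : ContDiffAt ℝ k (fun y ↦ Real.sqrt |(A y).det|) x :=
  ((contDiffAt_det hA).abs hx).sqrt (abs_ne_zero.2 hx)

/-- Along the line `a + s X` the determinant is `det a · det (1 + s a⁻¹ X)`, and the second factor
is `1 + s tr (a⁻¹ X)` plus `s²` times a polynomial in `s`. Comparing derivatives at `s = 0` gives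
the formula. -/
theorem fderiv_det_of_apply {a : ι → ι → ℝ} (ha : (Matrix.of a).det ≠ 0) (X : ι → ι → ℝ) :
    DifferentiableAt ℝ (fun a : ι → ι → ℝ ↦ (Matrix.of a).det) a ∧
    fderiv ℝ (fun a : ι → ι → ℝ ↦ (Matrix.of a).det) a X =
      (Matrix.of a).det * ((Matrix.of a)⁻¹ * Matrix.of X).trace := by
  have hD : DifferentiableAt ℝ (fun a : ι → ι → ℝ ↦ (Matrix.of a).det) a :=
    (contDiffAt_det (k := 1) (A := fun a : ι → ι → ℝ ↦ Matrix.of a) fun i j ↦ by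
      simp only [Matrix.of_apply]
      fun_prop).differentiableAt one_ne_zero
  refine ⟨hD, ?_⟩
  have h1 : HasDerivAt (fun s : ℝ ↦ a + s • X) X 0 := by
    simpa using ((hasDerivAt_id (0 : ℝ)).smul_const X).const_add a
  have h2 := HasFDerivAt.comp_hasDerivAt_of_eq (0 : ℝ) hD.hasFDerivAt h1 (by simp)
  have h3 : ((fun a : ι → ι → ℝ ↦ (Matrix.of a).det) ∘ fun s : ℝ ↦ a + s • X) =
      fun s ↦ (Matrix.of a).det * (1 + ((Matrix.of a)⁻¹ * Matrix.of X).trace * s +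
        (Matrix.det (1 + (Polynomial.X : Polynomial ℝ) •
          ((Matrix.of a)⁻¹ * Matrix.of X).map Polynomial.C)).divX.divX.eval s * s ^ 2) := by
    funext s
    rw [← Matrix.det_one_add_smul, ← Matrix.det_mul, mul_add, mul_one, mul_smul_comm,
      Matrix.mul_nonsing_inv_cancel_left _ _ ha.isUnit]
    rfl
  rw [h3] at h2
  have h4 (c r : ℝ) (p : Polynomial ℝ) :
      HasDerivAt (fun s ↦ c * (1 + r * s + p.eval s * s ^ 2)) (c * r) 0 := by
    have := ((((hasDerivAt_id (0 : ℝ)).const_mul r).const_add 1).add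
      ((p.hasDerivAt 0).mul ((hasDerivAt_id (0 : ℝ)).pow 2))).const_mul c
    simpa using this
  exact h2.unique (h4 _ _ _)

/-- Jacobi's formula at an invertible matrix. -/
theorem fderiv_det_apply (hA : ∀ i j, DifferentiableAt ℝ (fun y ↦ A y i j) x)
    (hx : (A x).det ≠ 0) (v : E) :
    DifferentiableAt ℝ (fun y ↦ (A y).det) x ∧ fderiv ℝ (fun y ↦ (A y).det) x v =
      (A x).det * ((A x)⁻¹ * Matrix.of fun i j ↦ fderiv ℝ (fun y ↦ A y i j) x v).trace := by
  have hA' : HasFDerivAt (fun y i j ↦ A y i j)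
      (ContinuousLinearMap.pi fun i ↦ ContinuousLinearMap.pi fun j ↦
        fderiv ℝ (fun y ↦ A y i j) x) x :=
    hasFDerivAt_pi.2 fun i ↦ hasFDerivAt_pi.2 fun j ↦ (hA i j).hasFDerivAt
  have hD (X) := fderiv_det_of_apply (a := fun i j ↦ A x i j) hx X
  have h : HasFDerivAt (fun y ↦ (A y).det) _ x :=
    HasFDerivAt.comp (f := fun y i j ↦ A y i j) x (hD 0).1.hasFDerivAt hA'
  refine ⟨h.differentiableAt, ?_⟩
  rw [h.fderiv]
  exact (hD _).2

/-- The derivative of the inverse of a matrix-valued function. -/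
theorem fderiv_matrixInv_apply (hA : ∀ i j, ContDiffAt ℝ 1 (fun y ↦ A y i j) x)
    (hx : (A x).det ≠ 0) (v : E) :
    (Matrix.of fun i j ↦ fderiv ℝ (fun y ↦ (A y)⁻¹ i j) x v) =
      -((A x)⁻¹ * (Matrix.of fun i j ↦ fderiv ℝ (fun y ↦ A y i j) x v) * (A x)⁻¹) := by
  have hdA (i j : ι) : DifferentiableAt ℝ (fun y ↦ A y i j) x :=
    (hA i j).differentiableAt one_ne_zero
  have hdN (i j : ι) : DifferentiableAt ℝ (fun y ↦ (A y)⁻¹ i j) x :=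
    (contDiffAt_matrixInv hA hx i j).differentiableAt one_ne_zero
  have hev : ∀ᶠ y in 𝓝 x, (A y).det ≠ 0 :=
    (contDiffAt_det hA).continuousAt.eventually_ne hx
  -- This is the derivative of the identity `A⁻¹ A = 1`, which holds near `x`.
  have key : (Matrix.of fun i j ↦ fderiv ℝ (fun y ↦ (A y)⁻¹ i j) x v) * A x +
      (A x)⁻¹ * (Matrix.of fun i j ↦ fderiv ℝ (fun y ↦ A y i j) x v) = 0 := by
    ext i j
    have h1 : (fun y ↦ ∑ a, (A y)⁻¹ i a * A y a j) =ᶠ[𝓝 x]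
        fun _ ↦ (1 : Matrix ι ι ℝ) i j := by
      filter_upwards [hev] with y hy
      rw [← Matrix.mul_apply, Matrix.nonsing_inv_mul _ hy.isUnit]
    have h2 := h1.fderiv_eq (𝕜 := ℝ)
    have h4 : HasFDerivAt (fun y ↦ ∑ a, (A y)⁻¹ i a * A y a j) _ x :=
      HasFDerivAt.fun_sum fun a _ ↦ (hdN i a).hasFDerivAt.mul (hdA a j).hasFDerivAt
    rw [h4.fderiv, fderiv_const_apply] at h2
    have h3 := congrArg (fun L ↦ L v) h2
    simp only [_root_.sum_apply, _root_.zero_apply] at h3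
    simp only [Matrix.add_apply, Matrix.mul_apply, Matrix.of_apply, Matrix.zero_apply]
    rw [← Finset.sum_add_distrib, ← h3]
    refine Finset.sum_congr rfl fun a _ ↦ ?_
    simp
    ring
  have h := congrArg (· * (A x)⁻¹) key
  simp only [add_mul, zero_mul] at h
  rw [Matrix.mul_nonsing_inv_cancel_right _ _ hx.isUnit] at h
  exact eq_neg_of_add_eq_zero_left h

end Matrix

/-! ### The d'Alembertian of a matrix-valued function on the coordinate space -/

section Laplace

variable {n : ℕ}

/-- The Jacobian matrix of a self-map of the coordinate space. -/
noncomputable def jacobian (τ : Coord n → Coord n) (y : Coord n) :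
    Matrix (Fin (n + 1)) (Fin (n + 1)) ℝ :=
  Matrix.of fun a i ↦ fderiv ℝ τ y (EuclideanSpace.single i (1 : ℝ)) a

/-- The second-order operator `|det A|^{-1/2} ∂_i (|det A|^{1/2} A^{ij} ∂_j u)`. -/
noncomputable def lap (A : Coord n → Matrix (Fin (n + 1)) (Fin (n + 1)) ℝ) (u : Coord n → ℂ)
    (y₀ : Coord n) : ℂ :=
  ((Real.sqrt |(A y₀).det| : ℝ) : ℂ)⁻¹ * ∑ i, partialDeriv i (fun y ↦ ∑ j,
    ((Real.sqrt |(A y).det| * (A y)⁻¹ i j : ℝ) : ℂ) * partialDeriv j u y) y₀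

theorem coord_eq_sum (w : Coord n) :
    w = ∑ b, w b • (EuclideanSpace.single b (1 : ℝ) : Coord n) := by
  ext i
  simp [Pi.single_apply]

theorem contDiffAt_partialDeriv {u : Coord n → ℂ} {y : Coord n} (hu : ContDiffAt ℝ ∞ u y)
    (i : Fin (n + 1)) : ContDiffAt ℝ ∞ (partialDeriv i u) y :=
  (hu.fderiv_right (m := ∞) (by simp)).clm_apply contDiffAt_const

theorem contDiffAt_jacobian {τ : Coord n → Coord n} {y : Coord n} (hτ : ContDiffAt ℝ ∞ τ y)
    (a i : Fin (n + 1)) : ContDiffAt ℝ ∞ (fun y ↦ jacobian τ y a i) y := by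
  have h : ContDiffAt ℝ ∞ (fun y ↦ fderiv ℝ τ y (EuclideanSpace.single i (1 : ℝ))) y :=
    (hτ.fderiv_right (m := ∞) (by simp)).clm_apply contDiffAt_const
  exact (EuclideanSpace.proj (𝕜 := ℝ) a).contDiff.contDiffAt.comp y h

theorem partialDeriv_comp {u : Coord n → ℂ} {τ : Coord n → Coord n} {y : Coord n}
    (hu : DifferentiableAt ℝ u (τ y)) (hτ : DifferentiableAt ℝ τ y) (i : Fin (n + 1)) :
    partialDeriv i (u ∘ τ) y = ∑ b, (jacobian τ y b i : ℂ) * partialDeriv b u (τ y) := by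
  unfold partialDeriv
  rw [fderiv_comp y hu hτ, ContinuousLinearMap.comp_apply]
  conv_lhs => rw [coord_eq_sum (fderiv ℝ τ y (EuclideanSpace.single i (1 : ℝ)))]
  rw [map_sum]
  refine Finset.sum_congr rfl fun b _ ↦ ?_
  rw [map_smul, Complex.real_smul]
  rfl

/-- Both sides are second derivatives of the component `a` of `τ`. This symmetry is what makes the
Piola identity hold. -/
theorem fderiv_jacobian_symm {τ : Coord n → Coord n} {y : Coord n} (hτ : ContDiffAt ℝ ∞ τ y)
    (a i j : Fin (n + 1)) :
    fderiv ℝ (fun y ↦ jacobian τ y a i) y (EuclideanSpace.single j (1 : ℝ)) =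
      fderiv ℝ (fun y ↦ jacobian τ y a j) y (EuclideanSpace.single i (1 : ℝ)) := by
  have hd : DifferentiableAt ℝ (fderiv ℝ τ) y :=
    (hτ.fderiv_right (m := ∞) (by simp)).differentiableAt (by simp)
  have h (i j : Fin (n + 1)) :
      fderiv ℝ (fun y ↦ jacobian τ y a i) y (EuclideanSpace.single j (1 : ℝ)) =
        fderiv ℝ (fderiv ℝ τ) y (EuclideanSpace.single j (1 : ℝ))
          (EuclideanSpace.single i (1 : ℝ)) a := by
    have h1 : HasFDerivAt (fun y ↦ fderiv ℝ τ y (EuclideanSpace.single i (1 : ℝ)))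
        ((fderiv ℝ (fderiv ℝ τ) y).flip (EuclideanSpace.single i (1 : ℝ))) y := by
      simpa using hd.hasFDerivAt.clm_apply (hasFDerivAt_const (EuclideanSpace.single i (1 : ℝ)) y)
    have h2 := (EuclideanSpace.proj (𝕜 := ℝ) a).hasFDerivAt.comp y h1
    have h3 : HasFDerivAt (fun y ↦ jacobian τ y a i) _ y := h2
    rw [h3.fderiv]
    rfl
  rw [h, h]
  have hs : IsSymmSndFDerivAt ℝ τ y := hτ.isSymmSndFDerivAt (by
    simpa using (WithTop.coe_le_coe.2 le_top : ((2 : ℕ∞) : WithTop ℕ∞) ≤ ∞))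
  rw [hs.eq]

/-- The derivative of the entries of the Piola transform `|det J| J⁻¹`. -/
theorem fderiv_abs_det_mul_inv {A : Coord n → Matrix (Fin (n + 1)) (Fin (n + 1)) ℝ} {y : Coord n}
    (hA : ∀ i j, ContDiffAt ℝ 1 (fun y ↦ A y i j) y) (hy : (A y).det ≠ 0) (v : Coord n)
    (i a : Fin (n + 1)) :
    DifferentiableAt ℝ (fun y ↦ |(A y).det| * (A y)⁻¹ i a) y ∧
    fderiv ℝ (fun y ↦ |(A y).det| * (A y)⁻¹ i a) y v = |(A y).det| *
      (((A y)⁻¹ * Matrix.of fun i j ↦ fderiv ℝ (fun y ↦ A y i j) y v).trace * (A y)⁻¹ i a -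
        ((A y)⁻¹ * (Matrix.of fun i j ↦ fderiv ℝ (fun y ↦ A y i j) y v) * (A y)⁻¹) i a) := by
  have h1 := fderiv_det_apply (fun i j ↦ (hA i j).differentiableAt one_ne_zero) hy v
  have h2 := congrFun (congrFun (fderiv_matrixInv_apply hA hy v) i) a
  rw [Matrix.of_apply, Matrix.neg_apply] at h2
  have hN : DifferentiableAt ℝ (fun y ↦ (A y)⁻¹ i a) y :=
    (contDiffAt_matrixInv hA hy i a).differentiableAt one_ne_zero
  have h3 : HasFDerivAt (fun y ↦ |(A y).det|)
      ((SignType.sign (A y).det : ℝ) • fderiv ℝ (fun y ↦ (A y).det) y) y :=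
    h1.1.hasFDerivAt.abs hy
  have h4 : HasFDerivAt (fun y ↦ |(A y).det| * (A y)⁻¹ i a) _ y := h3.mul hN.hasFDerivAt
  refine ⟨h4.differentiableAt, ?_⟩
  rw [h4.fderiv]
  simp only [_root_.add_apply, _root_.smul_apply, smul_eq_mul, h1.2, h2]
  have h5 : (SignType.sign (A y).det : ℝ) * (A y).det = |(A y).det| := sign_mul_self _
  rw [← mul_assoc (SignType.sign (A y).det : ℝ), h5]
  ring

/-- The Piola identity `∂_i (|det J| (J⁻¹)_{ia}) = 0`. -/
theorem piola_identity {τ : Coord n → Coord n} {y : Coord n} (hτ : ContDiffAt ℝ ∞ τ y)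
    (hy : (jacobian τ y).det ≠ 0) (a : Fin (n + 1)) :
    ∑ i, fderiv ℝ (fun y ↦ |(jacobian τ y).det| * (jacobian τ y)⁻¹ i a) y
      (EuclideanSpace.single i (1 : ℝ)) = 0 := by
  have hA (i j) : ContDiffAt ℝ 1 (fun y ↦ jacobian τ y i j) y :=
    (contDiffAt_jacobian hτ i j).of_le (by simp)
  simp only [fun i ↦ (fderiv_abs_det_mul_inv hA hy (EuclideanSpace.single i (1 : ℝ)) i a).2]
  rw [← Finset.mul_sum, Finset.sum_sub_distrib]
  convert mul_zero _
  rw [sub_eq_zero]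
  -- In indices, the trace term contains `∂_i J_{cb}` where the other term contains `∂_b J_{ci}`,
  -- with the same inverse entries after renaming; symmetry of second derivatives identifies them.
  simp only [Matrix.trace, Matrix.diag_apply, Matrix.mul_apply, Matrix.of_apply, Finset.sum_mul]
  rw [Finset.sum_comm]
  refine Finset.sum_congr rfl fun c _ ↦ ?_
  refine Finset.sum_congr rfl fun i _ ↦ ?_
  refine Finset.sum_congr rfl fun b _ ↦ ?_
  rw [fderiv_jacobian_symm hτ b c i]

/-- The divergence of the Piola transform of a vector field. -/
theorem sum_partialDeriv_piola {τ : Coord n → Coord n} {y : Coord n} (hτ : ContDiffAt ℝ ∞ τ y)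
    (hy : (jacobian τ y).det ≠ 0) {X : Fin (n + 1) → Coord n → ℂ}
    (hX : ∀ a, DifferentiableAt ℝ (X a) (τ y)) :
    ∑ i, partialDeriv i (fun y ↦ ∑ a,
      ((|(jacobian τ y).det| * (jacobian τ y)⁻¹ i a : ℝ) : ℂ) * X a (τ y)) y =
        ((|(jacobian τ y).det| : ℝ) : ℂ) * ∑ a, partialDeriv a (X a) (τ y) := by
  have hA (i j) : ContDiffAt ℝ 1 (fun y ↦ jacobian τ y i j) y :=
    (contDiffAt_jacobian hτ i j).of_le (by simp)
  have hτ' : DifferentiableAt ℝ τ y := hτ.differentiableAt (by simp)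
  obtain ⟨c, hc⟩ : ∃ c : Fin (n + 1) → Fin (n + 1) → Coord n → ℝ,
    c = fun i a y ↦ |(jacobian τ y).det| * (jacobian τ y)⁻¹ i a := ⟨_, rfl⟩
  have hcd (i a) : DifferentiableAt ℝ (c i a) y := by
    rw [hc]
    exact (fderiv_abs_det_mul_inv hA hy 0 i a).1
  have hcc (i a) : HasFDerivAt (fun y ↦ (c i a y : ℂ))
      (Complex.ofRealCLM.comp (fderiv ℝ (c i a) y)) y :=
    Complex.ofRealCLM.hasFDerivAt.comp y (hcd i a).hasFDerivAt
  have hXd (a) : HasFDerivAt (fun y ↦ X a (τ y)) (fderiv ℝ (X a ∘ τ) y) y :=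
    ((hX a).comp y hτ').hasFDerivAt
  have h1 (i) : partialDeriv i (fun y ↦ ∑ a, (c i a y : ℂ) * X a (τ y)) y =
      ∑ a, ((c i a y : ℂ) * (∑ b, (jacobian τ y b i : ℂ) * partialDeriv b (X a) (τ y)) +
        (fderiv ℝ (c i a) y (EuclideanSpace.single i (1 : ℝ)) : ℂ) * X a (τ y)) := by
    have : HasFDerivAt (fun y ↦ ∑ a, (c i a y : ℂ) * X a (τ y)) _ y :=
      HasFDerivAt.fun_sum fun a _ ↦ (hcc i a).mul (hXd a)
    rw [partialDeriv, this.fderiv]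
    simp only [_root_.sum_apply, _root_.add_apply,
      _root_.smul_apply, smul_eq_mul, ContinuousLinearMap.comp_apply]
    refine Finset.sum_congr rfl fun a _ ↦ ?_
    rw [← partialDeriv_comp (hX a) hτ' i]
    simp only [partialDeriv, Complex.ofRealCLM_apply]
    ring
  have h0 : ∑ i, partialDeriv i (fun y ↦ ∑ a,
      ((|(jacobian τ y).det| * (jacobian τ y)⁻¹ i a : ℝ) : ℂ) * X a (τ y)) y =
        ∑ i, partialDeriv i (fun y ↦ ∑ a, (c i a y : ℂ) * X a (τ y)) y := by
    rw [hc]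
  rw [h0]
  simp only [h1, Finset.sum_add_distrib]
  -- The terms in which the derivative falls on a coefficient cancel by the Piola identity.
  have h2 : ∑ i, ∑ a, (fderiv ℝ (c i a) y (EuclideanSpace.single i (1 : ℝ)) : ℂ) * X a (τ y) =
      0 := by
    rw [Finset.sum_comm]
    refine Finset.sum_eq_zero fun a _ ↦ ?_
    rw [← Finset.sum_mul, ← Complex.ofReal_sum, hc, piola_identity hτ hy a]
    simp
  rw [h2, add_zero, Finset.sum_comm, Finset.mul_sum]
  refine Finset.sum_congr rfl fun a _ ↦ ?_
  simp only [Finset.mul_sum]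
  rw [Finset.sum_comm]
  -- In the remaining terms the Jacobian from the chain rule meets its inverse, leaving a Kronecker
  -- delta.
  have h3 (b : Fin (n + 1)) : ∑ i, (c i a y : ℂ) *
      ((jacobian τ y b i : ℂ) * partialDeriv b (X a) (τ y)) =
        ((|(jacobian τ y).det| : ℝ) : ℂ) * ((1 : Matrix (Fin (n + 1)) (Fin (n + 1)) ℝ) b a : ℂ) *
          partialDeriv b (X a) (τ y) := by
    rw [← Matrix.mul_nonsing_inv _ hy.isUnit, Matrix.mul_apply, Complex.ofReal_sum,
      Finset.mul_sum, Finset.sum_mul]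
    refine Finset.sum_congr rfl fun i _ ↦ ?_
    simp only [hc]
    push_cast
    ring
  simp only [h3]
  rw [Finset.sum_eq_single a]
  · rw [Matrix.one_apply_eq, Complex.ofReal_one, mul_one]
  · intro b _ hb
    rw [Matrix.one_apply_ne hb, Complex.ofReal_zero, mul_zero, zero_mul]
  · simp

variable {A B : Coord n → Matrix (Fin (n + 1)) (Fin (n + 1)) ℝ} {u : Coord n → ℂ} {y : Coord n}

theorem contDiffAt_flux (hB : ∀ i j, ContDiffAt ℝ ∞ (fun y ↦ B y i j) y) (hdet : (B y).det ≠ 0)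
    (hu : ContDiffAt ℝ ∞ u y) (i : Fin (n + 1)) :
    ContDiffAt ℝ ∞ (fun y ↦ ∑ j,
      ((Real.sqrt |(B y).det| * (B y)⁻¹ i j : ℝ) : ℂ) * partialDeriv j u y) y := by
  refine ContDiffAt.sum fun j _ ↦ ContDiffAt.mul ?_ (contDiffAt_partialDeriv hu j)
  exact Complex.ofRealCLM.contDiff.contDiffAt.comp y
    ((contDiffAt_sqrt_abs_det hB hdet).mul (contDiffAt_matrixInv hB hdet i j))

theorem contDiffAt_lap (hB : ∀ i j, ContDiffAt ℝ ∞ (fun y ↦ B y i j) y) (hdet : (B y).det ≠ 0)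
    (hu : ContDiffAt ℝ ∞ u y) : ContDiffAt ℝ ∞ (lap B u) y := by
  refine ContDiffAt.mul (ContDiffAt.inv ?_ ?_)
    (ContDiffAt.sum fun i _ ↦ contDiffAt_partialDeriv (contDiffAt_flux hB hdet hu i) i)
  · exact Complex.ofRealCLM.contDiff.contDiffAt.comp y (contDiffAt_sqrt_abs_det hB hdet)
  · simpa [Real.sqrt_eq_zero] using hdet

/-- The operator `lap` is natural under coordinate changes. -/
theorem lap_comp {τ : Coord n → Coord n} (hτ : ContDiffAt ℝ ∞ τ y)
    (hy : (jacobian τ y).det ≠ 0) (hB : ∀ i j, ContDiffAt ℝ ∞ (fun y ↦ B y i j) (τ y))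
    (hdet : (B (τ y)).det ≠ 0) (hu : ContDiffAt ℝ ∞ u (τ y))
    (hA : ∀ᶠ z in 𝓝 y, A z = (jacobian τ z).transpose * B (τ z) * jacobian τ z) :
    lap A (u ∘ τ) y = lap B u (τ y) := by
  have hρ (z : Coord n) (hz : A z = (jacobian τ z).transpose * B (τ z) * jacobian τ z) :
      Real.sqrt |(A z).det| = |(jacobian τ z).det| * Real.sqrt |(B (τ z)).det| := by
    rw [hz, Matrix.det_mul, Matrix.det_mul, Matrix.det_transpose, mul_right_comm, abs_mul,
      abs_mul, Real.sqrt_mul (by positivity), Real.sqrt_mul_self (abs_nonneg _)]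
  -- The flux of `u ∘ τ` is the Piola transform of the flux of `u`, because `A⁻¹ Jᵀ = J⁻¹ B⁻¹`. The
  -- flux is differentiated afterwards, so this is needed on a neighbourhood and not only at `y`.
  have hflux (i : Fin (n + 1)) : (fun z ↦ ∑ j,
      ((Real.sqrt |(A z).det| * (A z)⁻¹ i j : ℝ) : ℂ) * partialDeriv j (u ∘ τ) z) =ᶠ[𝓝 y]
      fun z ↦ ∑ a, ((|(jacobian τ z).det| * (jacobian τ z)⁻¹ i a : ℝ) : ℂ) *
        (fun w ↦ ∑ j, ((Real.sqrt |(B w).det| * (B w)⁻¹ a j : ℝ) : ℂ) * partialDeriv j u w)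
          (τ z) := by
    have hJ : ∀ᶠ z in 𝓝 y, (jacobian τ z).det ≠ 0 :=
      (contDiffAt_det fun i j ↦ contDiffAt_jacobian hτ i j).continuousAt.eventually_ne hy
    have hτ1 : ∀ᶠ z in 𝓝 y, DifferentiableAt ℝ τ z := by
      filter_upwards [(hτ.of_le (show (1 : WithTop ℕ∞) ≤ ∞ by simp)).eventually (by simp)] with z hz
      exact hz.differentiableAt one_ne_zero
    have hu1 : ∀ᶠ z in 𝓝 y, DifferentiableAt ℝ u (τ z) := by
      refine hτ.continuousAt.eventually ?_
      filter_upwards [(hu.of_le (show (1 : WithTop ℕ∞) ≤ ∞ by simp)).eventually (by simp)] with z hz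
      exact hz.differentiableAt one_ne_zero
    filter_upwards [hA, hJ, hτ1, hu1] with z hz hJz hτz huz
    simp only [hρ z hz, partialDeriv_comp huz hτz, Finset.mul_sum]
    have hinv : (A z)⁻¹ * (jacobian τ z).transpose = (jacobian τ z)⁻¹ * (B (τ z))⁻¹ := by
      rw [hz, Matrix.mul_inv_rev, Matrix.mul_inv_rev, mul_assoc, mul_assoc,
        Matrix.nonsing_inv_mul _ (by simpa using hJz.isUnit), mul_one]
    rw [Finset.sum_comm, Finset.sum_comm (f := fun a j ↦
      ((|(jacobian τ z).det| * (jacobian τ z)⁻¹ i a : ℝ) : ℂ) * _)]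
    refine Finset.sum_congr rfl fun b _ ↦ ?_
    have h1 := congrFun (congrFun hinv i) b
    rw [Matrix.mul_apply, Matrix.mul_apply] at h1
    have h2 : ∑ j, (((A z)⁻¹ i j : ℝ) : ℂ) * (jacobian τ z b j : ℂ) =
        ∑ a, (((jacobian τ z)⁻¹ i a : ℝ) : ℂ) * ((B (τ z))⁻¹ a b : ℂ) := by
      have := congrArg (fun r : ℝ ↦ (r : ℂ)) h1
      simpa using this
    calc _ = ((|(jacobian τ z).det| : ℝ) : ℂ) * (Real.sqrt |(B (τ z)).det| : ℂ) *
          (∑ j, (((A z)⁻¹ i j : ℝ) : ℂ) * (jacobian τ z b j : ℂ)) * partialDeriv b u (τ z) := by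
          rw [Finset.mul_sum, Finset.sum_mul]
          refine Finset.sum_congr rfl fun j _ ↦ ?_
          push_cast
          ring
      _ = _ := by
          rw [h2, Finset.mul_sum, Finset.sum_mul]
          refine Finset.sum_congr rfl fun j _ ↦ ?_
          push_cast
          ring
  unfold lap
  have h1 : ∑ i, partialDeriv i (fun z ↦ ∑ j,
      ((Real.sqrt |(A z).det| * (A z)⁻¹ i j : ℝ) : ℂ) * partialDeriv j (u ∘ τ) z) y = _ :=
    (Finset.sum_congr rfl fun i _ ↦ by
      rw [partialDeriv, (hflux i).fderiv_eq]
      rfl).trans (sum_partialDeriv_piola hτ hy fun a ↦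
        (contDiffAt_flux hB hdet hu a).differentiableAt (by simp))
  rw [h1, hρ y hA.self_of_nhds]
  have h2 : ((|(jacobian τ y).det| : ℝ) : ℂ) ≠ 0 := by simpa using hy
  push_cast
  field_simp

end Laplace

/-! ### The metric in charts -/

section Charts

variable {n : ℕ} {M : Type*} [TopologicalSpace M] [ChartedSpace (Coord n) M]

/-- The derivative of the inverse of the chart at `p`. -/
noncomputable def chartDeriv (p : M) (y : Coord n) : Coord n →L[ℝ] Coord n :=
  mfderiv (𝓡 (n + 1)) (𝓡 (n + 1)) (chartAt (Coord n) p).symm y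

variable [IsManifold (𝓡 (n + 1)) ∞ M]

/-- The metric as a family of bilinear forms on the model space. -/
noncomputable def metricForm (g : LorentzMetric n M) (x : M) : Coord n →L[ℝ] Coord n →L[ℝ] ℝ :=
  g.inner x

theorem gram_apply (g : LorentzMetric n M) (p : M) (y : Coord n) (i j : Fin (n + 1)) :
    gram g p y i j = metricForm g ((chartAt (Coord n) p).symm y)
      (chartDeriv p y (EuclideanSpace.single i 1)) (chartDeriv p y (EuclideanSpace.single j 1)) :=
  rfl

theorem contMDiffAt_chart_symm {p : M} {y : Coord n} (hy : y ∈ (chartAt (Coord n) p).target) :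
    ContMDiffAt (𝓡 (n + 1)) (𝓡 (n + 1)) ∞ (chartAt (Coord n) p).symm y :=
  (contMDiffOn_chart_symm (I := 𝓡 (n + 1)) (x := p) y hy).contMDiffAt
    ((chartAt (Coord n) p).open_target.mem_nhds hy)

theorem contMDiffAt_chart {p x : M} (hx : x ∈ (chartAt (Coord n) p).source) :
    ContMDiffAt (𝓡 (n + 1)) (𝓡 (n + 1)) ∞ (chartAt (Coord n) p) x :=
  (contMDiffOn_chart (I := 𝓡 (n + 1)) (x := p) x hx).contMDiffAt
    ((chartAt (Coord n) p).open_source.mem_nhds hx)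

theorem chartDeriv_bijective {p : M} {y : Coord n} (hy : y ∈ (chartAt (Coord n) p).target) :
    Function.Bijective (chartDeriv p y) := by
  have : IsManifold (𝓡 (n + 1)) 1 M := .of_le (n := ∞) (by simp)
  have h := (mdifferentiable_chart (I := 𝓡 (n + 1)) p).symm.mfderiv_bijective hy
  exact h

/-- The metric is smooth in charts. -/
theorem contDiffAt_metricForm_chartDeriv (g : LorentzMetric n M) {p : M} {y : Coord n}
    (hy : y ∈ (chartAt (Coord n) p).target) (v w : Coord n) :
    ContDiffAt ℝ ∞ (fun y ↦ metricForm g ((chartAt (Coord n) p).symm y) (chartDeriv p y v)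
      (chartDeriv p y w)) y := by
  have : IsManifold (𝓡 (n + 1)) 1 M := .of_le (n := ∞) (by simp)
  -- A constant coordinate field, pushed forward by the inverse chart, is a smooth field along that
  -- inverse chart; the smooth metric can then be evaluated on two of them.
  have hsec (v : Coord n) : ContMDiffAt (𝓡 (n + 1)) (𝓡 (n + 1)).tangent ∞
      (fun y ↦ TotalSpace.mk' (Coord n) (E := (TangentSpace (𝓡 (n + 1)) : M → Type))
        ((chartAt (Coord n) p).symm y)
        (mfderiv (𝓡 (n + 1)) (𝓡 (n + 1)) (chartAt (Coord n) p).symm y v)) y := by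
    have h1 : ContMDiffWithinAt (𝓡 (n + 1)).tangent (𝓡 (n + 1)).tangent ∞
        (tangentMapWithin (𝓡 (n + 1)) (𝓡 (n + 1)) (chartAt (Coord n) p).symm
          (chartAt (Coord n) p).target)
        (TotalSpace.proj ⁻¹' (chartAt (Coord n) p).target)
        (TotalSpace.mk' (Coord n) (E := (TangentSpace (𝓡 (n + 1)) : Coord n → Type)) y v) :=
      (contMDiffOn_chart_symm (I := 𝓡 (n + 1)) (n := ∞) (x := p)).contMDiffOn_tangentMapWithin
        (by simp) ((chartAt (Coord n) p).open_target.uniqueMDiffOn) _ hy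
    have h2 : ContMDiffAt (𝓡 (n + 1)) (𝓡 (n + 1)).tangent ∞
        (fun y ↦ TotalSpace.mk' (Coord n) (E := (TangentSpace (𝓡 (n + 1)) : Coord n → Type)) y v)
        y := contMDiffAt_vectorSpace_iff_contDiffAt.2 contDiffAt_const
    have h3 := h1.comp (s := (chartAt (Coord n) p).target) y h2.contMDiffWithinAt
      (fun z hz ↦ hz)
    have h4 := h3.contMDiffAt ((chartAt (Coord n) p).open_target.mem_nhds hy)
    refine h4.congr_of_eventuallyEq ?_
    filter_upwards [(chartAt (Coord n) p).open_target.mem_nhds hy] with z hz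
    simp only [Function.comp_apply, tangentMapWithin,
      mfderivWithin_of_isOpen (chartAt (Coord n) p).open_target hz]
  have hg := g.contMDiff.contMDiffAt.comp y (contMDiffAt_chart_symm (p := p) hy)
  have h := ContMDiffAt.clm_bundle_apply₂ (F₁ := Coord n) (F₂ := Coord n) (F₃ := ℝ)
    (E₃ := Bundle.Trivial M ℝ) hg (hsec v) (hsec w)
  simp only [contMDiffAt_totalSpace] at h
  exact h.2.contDiffAt

theorem contDiffAt_gram (g : LorentzMetric n M) {p : M} {y : Coord n}
    (hy : y ∈ (chartAt (Coord n) p).target) (i j : Fin (n + 1)) :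
    ContDiffAt ℝ ∞ (fun y ↦ gram g p y i j) y :=
  contDiffAt_metricForm_chartDeriv g hy _ _

/-- The metric is nondegenerate. -/
theorem metricForm_nondegenerate (g : LorentzMetric n M) (x : M) (w : Coord n)
    (hw : ∀ v, metricForm g x v w = 0) : w = 0 := by
  obtain ⟨e, he⟩ := g.signature x
  let e' : Module.Basis (Fin (n + 1)) ℝ (Coord n) := e
  have he' (i j) : metricForm g x (e' i) (e' j) =
      if i = j then (if i = 0 then 1 else -1) else 0 := he i j
  have h1 : ∀ i, e'.repr w i = 0 := by
    intro i
    have h := hw (e' i)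
    rw [← e'.sum_repr w, map_sum] at h
    simp only [map_smul, he', smul_eq_mul, mul_ite, mul_zero, Finset.sum_ite_eq,
      Finset.mem_univ, if_true] at h
    split_ifs at h <;> linarith
  exact e'.ext_elem fun i ↦ by simp [h1 i]

/-- A vector in the kernel of the Gram matrix yields a tangent vector orthogonal to everything,
since the chart derivative is onto. It is zero by nondegeneracy, and injectivity of the chart
derivative returns to the coefficients. -/
theorem det_gram_ne_zero (g : LorentzMetric n M) {p : M} {y : Coord n}
    (hy : y ∈ (chartAt (Coord n) p).target) : (gram g p y).det ≠ 0 := by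
  intro h
  obtain ⟨c, hc0, hc⟩ := Matrix.exists_mulVec_eq_zero_iff.2 h
  obtain ⟨w, hw⟩ : ∃ w : Coord n, w = ∑ j, c j • EuclideanSpace.single j (1 : ℝ) := ⟨_, rfl⟩
  have hw0 : chartDeriv p y w = 0 := by
    refine metricForm_nondegenerate g ((chartAt (Coord n) p).symm y) _ fun v ↦ ?_
    obtain ⟨v, rfl⟩ := (chartDeriv_bijective hy).2 v
    rw [coord_eq_sum v, map_sum, map_sum, _root_.sum_apply]
    refine Finset.sum_eq_zero fun i _ ↦ ?_
    have hi := congrFun hc i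
    simp only [Matrix.mulVec, dotProduct, gram_apply, Pi.zero_apply] at hi
    rw [map_smul, map_smul, _root_.smul_apply, hw, map_sum, map_sum]
    simp only [map_smul, smul_eq_mul]
    rw [← mul_zero (v i), ← hi]
    congr 1
    exact Finset.sum_congr rfl fun j _ ↦ mul_comm _ _
  have hw1 : w = 0 := (chartDeriv_bijective hy).1 (by rw [hw0, map_zero])
  apply hc0
  funext i
  have := congrArg (fun u : Coord n ↦ u i) (hw.symm.trans hw1)
  simpa [Pi.single_apply] using this

/-! ### Isometries in charts -/

/-- The coordinate expression of a self-map in the charts at `p` and `q`. -/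
noncomputable def inCharts (p q : M) (α : M → M) : Coord n → Coord n :=
  fun y ↦ chartAt (Coord n) q (α ((chartAt (Coord n) p).symm y))

variable {g : LorentzMetric n M} {p q : M} {α : M ≃ₘ^∞⟮𝓡 (n + 1), 𝓡 (n + 1)⟯ M} {y : Coord n}

theorem contDiffAt_inCharts (hy : y ∈ (chartAt (Coord n) p).target)
    (hq : α ((chartAt (Coord n) p).symm y) ∈ (chartAt (Coord n) q).source) :
    ContDiffAt ℝ ∞ (inCharts p q α) y :=
  ((contMDiffAt_chart hq).comp y
    (α.contMDiff.contMDiffAt.comp y (contMDiffAt_chart_symm hy))).contDiffAt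

theorem symm_inCharts (hq : α ((chartAt (Coord n) p).symm y) ∈ (chartAt (Coord n) q).source) :
    (chartAt (Coord n) q).symm (inCharts p q α y) = α ((chartAt (Coord n) p).symm y) :=
  (chartAt (Coord n) q).left_inv hq

theorem inCharts_mem_target
    (hq : α ((chartAt (Coord n) p).symm y) ∈ (chartAt (Coord n) q).source) :
    inCharts p q α y ∈ (chartAt (Coord n) q).target :=
  (chartAt (Coord n) q).map_source hq

theorem eventually_inCharts (hy : y ∈ (chartAt (Coord n) p).target)
    (hq : α ((chartAt (Coord n) p).symm y) ∈ (chartAt (Coord n) q).source) :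
    ∀ᶠ z in 𝓝 y, z ∈ (chartAt (Coord n) p).target ∧
      α ((chartAt (Coord n) p).symm z) ∈ (chartAt (Coord n) q).source := by
  have h : ∀ᶠ z in 𝓝 y, z ∈ (chartAt (Coord n) p).target :=
    (chartAt (Coord n) p).open_target.mem_nhds hy
  exact h.and <| (α.continuous.continuousAt.comp (contMDiffAt_chart_symm hy).continuousAt).eventually
    ((chartAt (Coord n) q).open_source.mem_nhds hq)

/-- Chain rule for the two expressions of the local map from coordinates to `M`: through the chart
at `q`, or through `α`. -/
theorem chartDeriv_inCharts (hy : y ∈ (chartAt (Coord n) p).target)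
    (hq : α ((chartAt (Coord n) p).symm y) ∈ (chartAt (Coord n) q).source) (v : Coord n) :
    chartDeriv q (inCharts p q α y) (fderiv ℝ (inCharts p q α) y v) =
      (mfderiv (𝓡 (n + 1)) (𝓡 (n + 1)) α ((chartAt (Coord n) p).symm y) :
        Coord n →L[ℝ] Coord n) (chartDeriv p y v) := by
  have hev : (chartAt (Coord n) q).symm ∘ inCharts p q α =ᶠ[𝓝 y]
      α ∘ (chartAt (Coord n) p).symm := by
    filter_upwards [eventually_inCharts hy hq] with z hz
    exact symm_inCharts hz.2
  have h1 := hev.mfderiv_eq (I := 𝓡 (n + 1)) (I' := 𝓡 (n + 1))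
  have h2 : MDifferentiableAt (𝓡 (n + 1)) (𝓡 (n + 1)) (chartAt (Coord n) q).symm
      (inCharts p q α y) :=
    (contMDiffAt_chart_symm (inCharts_mem_target hq)).mdifferentiableAt (by simp)
  have h3 : MDifferentiableAt (𝓡 (n + 1)) (𝓡 (n + 1)) (inCharts p q α) y :=
    ((contDiffAt_inCharts hy hq).differentiableAt (by simp)).mdifferentiableAt
  have h4 : MDifferentiableAt (𝓡 (n + 1)) (𝓡 (n + 1)) (chartAt (Coord n) p).symm y :=
    (contMDiffAt_chart_symm hy).mdifferentiableAt (by simp)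
  have h5 : MDifferentiableAt (𝓡 (n + 1)) (𝓡 (n + 1)) α ((chartAt (Coord n) p).symm y) :=
    α.contMDiff.contMDiffAt.mdifferentiableAt (by simp)
  have h6 := (mfderiv_comp y h2 h3).symm.trans (h1.trans (mfderiv_comp y h5 h4))
  rw [mfderiv_eq_fderiv] at h6
  exact congrArg (fun L : Coord n →L[ℝ] Coord n ↦ L v) h6

/-- The relation `A = Jᵀ B J` is the form in which being an isometry enters both `lap_comp` and the
change of variables for the volume. -/
theorem gram_inCharts
    (hα : ∀ (x : M) (v w : TangentSpace (𝓡 (n + 1)) x),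
      g.inner (α x) (mfderiv (𝓡 (n + 1)) (𝓡 (n + 1)) α x v)
        (mfderiv (𝓡 (n + 1)) (𝓡 (n + 1)) α x w) = g.inner x v w)
    (hy : y ∈ (chartAt (Coord n) p).target)
    (hq : α ((chartAt (Coord n) p).symm y) ∈ (chartAt (Coord n) q).source) :
    gram g p y = (jacobian (inCharts p q α) y).transpose * gram g q (inCharts p q α y) *
      jacobian (inCharts p q α) y := by
  have hα' (v w : Coord n) : metricForm g (α ((chartAt (Coord n) p).symm y))
      ((mfderiv (𝓡 (n + 1)) (𝓡 (n + 1)) α ((chartAt (Coord n) p).symm y) :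
        Coord n →L[ℝ] Coord n) v)
      ((mfderiv (𝓡 (n + 1)) (𝓡 (n + 1)) α ((chartAt (Coord n) p).symm y) :
        Coord n →L[ℝ] Coord n) w) = metricForm g ((chartAt (Coord n) p).symm y) v w :=
    hα _ v w
  ext i j
  rw [gram_apply, ← hα', ← chartDeriv_inCharts hy hq, ← chartDeriv_inCharts hy hq,
    ← symm_inCharts hq, coord_eq_sum (fderiv ℝ (inCharts p q α) y (EuclideanSpace.single i 1)),
    coord_eq_sum (fderiv ℝ (inCharts p q α) y (EuclideanSpace.single j 1))]
  simp only [map_sum, map_smul, _root_.sum_apply, _root_.smul_apply, smul_eq_mul, ← gram_apply]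
  simp only [Matrix.mul_apply, Matrix.transpose_apply, Finset.sum_mul]
  refine Finset.sum_congr rfl fun b _ ↦ ?_
  rw [Finset.mul_sum]
  refine Finset.sum_congr rfl fun a _ ↦ ?_
  simp only [jacobian, Matrix.of_apply]
  ring

theorem det_jacobian_inCharts_ne_zero
    (hα : ∀ (x : M) (v w : TangentSpace (𝓡 (n + 1)) x),
      g.inner (α x) (mfderiv (𝓡 (n + 1)) (𝓡 (n + 1)) α x v)
        (mfderiv (𝓡 (n + 1)) (𝓡 (n + 1)) α x w) = g.inner x v w)
    (hy : y ∈ (chartAt (Coord n) p).target)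
    (hq : α ((chartAt (Coord n) p).symm y) ∈ (chartAt (Coord n) q).source) :
    (jacobian (inCharts p q α) y).det ≠ 0 := by
  intro h
  apply det_gram_ne_zero g hy
  rw [gram_inCharts hα hy hq, Matrix.det_mul, h, mul_zero]

theorem density_inCharts
    (hα : ∀ (x : M) (v w : TangentSpace (𝓡 (n + 1)) x),
      g.inner (α x) (mfderiv (𝓡 (n + 1)) (𝓡 (n + 1)) α x v)
        (mfderiv (𝓡 (n + 1)) (𝓡 (n + 1)) α x w) = g.inner x v w)
    (hy : y ∈ (chartAt (Coord n) p).target)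
    (hq : α ((chartAt (Coord n) p).symm y) ∈ (chartAt (Coord n) q).source) :
    density g p y = |(jacobian (inCharts p q α) y).det| * density g q (inCharts p q α y) := by
  rw [density, density, gram_inCharts hα hy hq, Matrix.det_mul, Matrix.det_mul,
    Matrix.det_transpose, mul_right_comm, abs_mul, abs_mul, Real.sqrt_mul (by positivity),
    Real.sqrt_mul_self (abs_nonneg _)]

theorem det_fderiv_eq_det_jacobian (τ : Coord n → Coord n) (y : Coord n) :
    (fderiv ℝ τ y).det = (jacobian τ y).det := by
  have h := LinearMap.det_toMatrix (EuclideanSpace.basisFun (Fin (n + 1)) ℝ).toBasis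
    (fderiv ℝ τ y : Coord n →ₗ[ℝ] Coord n)
  rw [ContinuousLinearMap.det, ← h]
  rfl

/-! ### The d'Alembertian in charts -/

theorem lap_congr {A : Coord n → Matrix (Fin (n + 1)) (Fin (n + 1)) ℝ} {u v : Coord n → ℂ}
    {y : Coord n} (h : u =ᶠ[𝓝 y] v) : lap A u y = lap A v y := by
  unfold lap
  congr 1
  refine Finset.sum_congr rfl fun i _ ↦ ?_
  have h1 : (fun y ↦ ∑ j, ((Real.sqrt |(A y).det| * (A y)⁻¹ i j : ℝ) : ℂ) * partialDeriv j u y)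
      =ᶠ[𝓝 y] fun y ↦ ∑ j,
        ((Real.sqrt |(A y).det| * (A y)⁻¹ i j : ℝ) : ℂ) * partialDeriv j v y := by
    filter_upwards [h.eventuallyEq_nhds] with z hz
    refine Finset.sum_congr rfl fun j _ ↦ ?_
    rw [partialDeriv, partialDeriv, hz.fderiv_eq]
  rw [partialDeriv, partialDeriv, h1.fderiv_eq]

theorem dAlembertian_eq_lap (g : LorentzMetric n M) (f : M → ℂ) (x : M) :
    dAlembertian g f x = lap (gram g x) (f ∘ (chartAt (Coord n) x).symm)
      (chartAt (Coord n) x x) := rfl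

theorem contDiffAt_comp_chart_symm {f : M → ℂ} (hy : y ∈ (chartAt (Coord n) p).target)
    (hf : ContMDiffAt (𝓡 (n + 1)) 𝓘(ℝ, ℂ) ∞ f ((chartAt (Coord n) p).symm y)) :
    ContDiffAt ℝ ∞ (f ∘ (chartAt (Coord n) p).symm) y :=
  (hf.comp y (contMDiffAt_chart_symm hy)).contDiffAt

/-- With the charts at `x` and `α x` this is naturality under isometries; with `α` the identity and
two arbitrary charts it is independence of the chart. -/
theorem lap_gram_inCharts
    (hα : ∀ (x : M) (v w : TangentSpace (𝓡 (n + 1)) x),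
      g.inner (α x) (mfderiv (𝓡 (n + 1)) (𝓡 (n + 1)) α x v)
        (mfderiv (𝓡 (n + 1)) (𝓡 (n + 1)) α x w) = g.inner x v w)
    (hy : y ∈ (chartAt (Coord n) p).target)
    (hq : α ((chartAt (Coord n) p).symm y) ∈ (chartAt (Coord n) q).source) {f : M → ℂ}
    (hf : ContMDiffAt (𝓡 (n + 1)) 𝓘(ℝ, ℂ) ∞ f (α ((chartAt (Coord n) p).symm y))) :
    lap (gram g p) ((f ∘ α) ∘ (chartAt (Coord n) p).symm) y =
      lap (gram g q) (f ∘ (chartAt (Coord n) q).symm) (inCharts p q α y) := by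
  have hev := eventually_inCharts hy hq
  have h1 : (f ∘ α) ∘ (chartAt (Coord n) p).symm =ᶠ[𝓝 y]
      (f ∘ (chartAt (Coord n) q).symm) ∘ inCharts p q α := by
    filter_upwards [hev] with z hz
    simp only [Function.comp_apply, symm_inCharts hz.2]
  rw [lap_congr h1]
  have ht := inCharts_mem_target hq
  refine lap_comp (contDiffAt_inCharts hy hq) (det_jacobian_inCharts_ne_zero hα hy hq)
    (fun i j ↦ contDiffAt_gram g ht i j) (det_gram_ne_zero g ht)
    (contDiffAt_comp_chart_symm ht ?_) ?_
  · rwa [symm_inCharts hq]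
  · filter_upwards [hev] with z hz
    exact gram_inCharts hα hz.1 hz.2

/-- Regarding the identity as an isometry turns each statement about isometries in two charts into a
coordinate-change rule. -/
theorem isometric_refl (g : LorentzMetric n M) (x : M) (v w : TangentSpace (𝓡 (n + 1)) x) :
    g.inner (Diffeomorph.refl (𝓡 (n + 1)) M ∞ x)
      (mfderiv (𝓡 (n + 1)) (𝓡 (n + 1)) (Diffeomorph.refl (𝓡 (n + 1)) M ∞) x v)
      (mfderiv (𝓡 (n + 1)) (𝓡 (n + 1)) (Diffeomorph.refl (𝓡 (n + 1)) M ∞) x w) =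
      g.inner x v w := by
  have h : mfderiv (𝓡 (n + 1)) (𝓡 (n + 1)) (Diffeomorph.refl (𝓡 (n + 1)) M ∞) x =
      ContinuousLinearMap.id ℝ (TangentSpace (𝓡 (n + 1)) x) := mfderiv_id
  rw [h]
  rfl

/-- The d'Alembertian commutes with isometries. -/
theorem dAlembertian_comp
    (hα : ∀ (x : M) (v w : TangentSpace (𝓡 (n + 1)) x),
      g.inner (α x) (mfderiv (𝓡 (n + 1)) (𝓡 (n + 1)) α x v)
        (mfderiv (𝓡 (n + 1)) (𝓡 (n + 1)) α x w) = g.inner x v w)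
    {f : M → ℂ} (hf : ContMDiff (𝓡 (n + 1)) 𝓘(ℝ, ℂ) ∞ f) (x : M) :
    dAlembertian g (f ∘ α) x = dAlembertian g f (α x) := by
  have hx := (chartAt (Coord n) x).left_inv (mem_chart_source (Coord n) x)
  rw [dAlembertian_eq_lap, dAlembertian_eq_lap,
    lap_gram_inCharts (q := α x) hα (mem_chart_target (Coord n) x)
      (by rw [hx]; exact mem_chart_source (Coord n) (α x)) hf.contMDiffAt, inCharts, hx]

/-- The d'Alembertian may be computed in any chart. -/
theorem dAlembertian_eq_lap_chart (g : LorentzMetric n M) {f : M → ℂ}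
    (hf : ContMDiff (𝓡 (n + 1)) 𝓘(ℝ, ℂ) ∞ f) {x p : M}
    (hx : x ∈ (chartAt (Coord n) p).source) :
    dAlembertian g f x = lap (gram g p) (f ∘ (chartAt (Coord n) p).symm)
      (chartAt (Coord n) p x) := by
  have h := lap_gram_inCharts (α := Diffeomorph.refl (𝓡 (n + 1)) M ∞) (q := p) (f := f)
    (isometric_refl g) (mem_chart_target (Coord n) x) (by simpa using hx) hf.contMDiffAt
  rw [dAlembertian_eq_lap]
  simpa [inCharts] using h

/-- By definition the operator uses a different chart at each point. Smoothness near `p` becomes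
visible once it is computed in the single chart at `p`. -/
theorem contMDiff_dAlembertian (g : LorentzMetric n M) {f : M → ℂ}
    (hf : ContMDiff (𝓡 (n + 1)) 𝓘(ℝ, ℂ) ∞ f) :
    ContMDiff (𝓡 (n + 1)) 𝓘(ℝ, ℂ) ∞ (dAlembertian g f) := by
  intro p
  have hp := mem_chart_target (Coord n) p
  have h1 := (contDiffAt_lap (fun i j ↦ contDiffAt_gram g hp i j) (det_gram_ne_zero g hp)
    (contDiffAt_comp_chart_symm hp hf.contMDiffAt)).contMDiffAt
  have h2 := h1.comp p (contMDiffAt_chart (mem_chart_source (Coord n) p))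
  refine h2.congr_of_eventuallyEq ?_
  filter_upwards [chart_source_mem_nhds (Coord n) p] with x hx
  exact dAlembertian_eq_lap_chart g hf hx

theorem dAlembertian_eq_zero (g : LorentzMetric n M) {f : M → ℂ} {x : M} (hf : f =ᶠ[𝓝 x] 0) :
    dAlembertian g f x = 0 := by
  have hx := mem_chart_target (Coord n) x
  have h : f ∘ (chartAt (Coord n) x).symm =ᶠ[𝓝 (chartAt (Coord n) x x)] fun _ ↦ 0 := by
    have h1 := (contMDiffAt_chart_symm (n := n) hx).continuousAt
    rw [ContinuousAt, (chartAt (Coord n) x).left_inv (mem_chart_source (Coord n) x)] at h1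
    exact h1.eventually hf
  rw [dAlembertian_eq_lap, lap_congr h]
  simp [lap, partialDeriv]

theorem isTest_kleinGordon [T2Space M] (g : LorentzMetric n M) (m : ℝ) {f : M → ℂ} (hf : IsTest n f) :
    IsTest n (kleinGordon g m f) := by
  refine ⟨(contMDiff_dAlembertian g hf.1).add
    ((contDiff_const.mul contDiff_id).contMDiff.comp hf.1), ?_⟩
  refine HasCompactSupport.of_support_subset_isCompact hf.2 fun x hx ↦ ?_
  by_contra h
  apply hx
  have h1 : f =ᶠ[𝓝 x] 0 := notMem_tsupport_iff_eventuallyEq.1 h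
  rw [kleinGordon, dAlembertian_eq_zero g h1, h1.self_of_nhds]
  simp

theorem kleinGordon_comp
    (hα : ∀ (x : M) (v w : TangentSpace (𝓡 (n + 1)) x),
      g.inner (α x) (mfderiv (𝓡 (n + 1)) (𝓡 (n + 1)) α x v)
        (mfderiv (𝓡 (n + 1)) (𝓡 (n + 1)) α x w) = g.inner x v w) (m : ℝ)
    {f : M → ℂ} (hf : ContMDiff (𝓡 (n + 1)) 𝓘(ℝ, ℂ) ∞ f) :
    kleinGordon g m (f ∘ α) = kleinGordon g m f ∘ α := by
  funext x
  simp only [kleinGordon, Function.comp_apply, dAlembertian_comp hα hf]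

end Charts

/-! ### The volume measure -/

section Volume

variable {n : ℕ} {M : Type*} [TopologicalSpace M] [ChartedSpace (Coord n) M]
  [IsManifold (𝓡 (n + 1)) ∞ M] [MeasurableSpace M] [BorelSpace M]
  {g : LorentzMetric n M} {p q : M} {α : M ≃ₘ^∞⟮𝓡 (n + 1), 𝓡 (n + 1)⟯ M}

theorem continuousOn_density (g : LorentzMetric n M) (p : M) :
    ContinuousOn (density g p) (chartAt (Coord n) p).target := fun _ hy ↦
  (contDiffAt_sqrt_abs_det (fun i j ↦ contDiffAt_gram g hy i j)
    (det_gram_ne_zero g hy)).continuousAt.continuousWithinAt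

theorem density_pos (g : LorentzMetric n M) {p : M} {y : Coord n}
    (hy : y ∈ (chartAt (Coord n) p).target) : 0 < density g p y :=
  Real.sqrt_pos.2 (abs_pos.2 (det_gram_ne_zero g hy))

theorem measurableSet_target_inter_preimage (p : M) {A : Set M} (hA : MeasurableSet A) :
    MeasurableSet ((chartAt (Coord n) p).target ∩ (chartAt (Coord n) p).symm ⁻¹' A) := by
  have h := (chartAt (Coord n) p).continuousOn_symm.domRestrict.measurable hA
  have h2 := (chartAt (Coord n) p).open_target.measurableSet.subtype_image h
  convert h2 using 1
  ext y
  simp [Set.domRestrict]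
  tauto

theorem chartVolume_apply (g : LorentzMetric n M) (p : M) {A : Set M} (hA : MeasurableSet A) :
    chartVolume g p A =
      ∫⁻ y in (chartAt (Coord n) p).target ∩ (chartAt (Coord n) p).symm ⁻¹' A,
        ENNReal.ofReal (density g p y) := by
  have hm : AEMeasurable (chartAt (Coord n) p).symm
      (((volume : Measure (Coord n)).restrict (chartAt (Coord n) p).target).withDensity
        (fun y ↦ ENNReal.ofReal (density g p y))) :=
    ((chartAt (Coord n) p).continuousOn_symm.aemeasurable
      (chartAt (Coord n) p).open_target.measurableSet).mono_ac (withDensity_absolutelyContinuous _ _)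
  rw [chartVolume, Measure.map_apply_of_aemeasurable hm hA, withDensity_apply',
    Measure.restrict_restrict' (chartAt (Coord n) p).open_target.measurableSet, inter_comm]

/-- Change of variables along the coordinate expression of `α`: the factor `|det J|` converts the
density at `q` into the density at `p`. -/
theorem chartVolume_image
    (hα : ∀ (x : M) (v w : TangentSpace (𝓡 (n + 1)) x),
      g.inner (α x) (mfderiv (𝓡 (n + 1)) (𝓡 (n + 1)) α x v)
        (mfderiv (𝓡 (n + 1)) (𝓡 (n + 1)) α x w) = g.inner x v w)
    {A : Set M} (hA : MeasurableSet A) (hp : A ⊆ (chartAt (Coord n) p).source)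
    (hq : α '' A ⊆ (chartAt (Coord n) q).source) :
    chartVolume g q (α '' A) = chartVolume g p A := by
  have hA' : MeasurableSet (α '' A) :=
    α.toHomeomorph.toMeasurableEquiv.measurableSet_image.2 hA
  rw [chartVolume_apply g p hA, chartVolume_apply g q hA']
  set P := (chartAt (Coord n) p).target ∩ (chartAt (Coord n) p).symm ⁻¹' A with hP
  have hPm : MeasurableSet P := measurableSet_target_inter_preimage p hA
  have hPq (y) (hy : y ∈ P) :
      α ((chartAt (Coord n) p).symm y) ∈ (chartAt (Coord n) q).source := hq ⟨_, hy.2, rfl⟩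
  have himg : (chartAt (Coord n) q).target ∩ (chartAt (Coord n) q).symm ⁻¹' (α '' A) =
      inCharts p q α '' P := by
    ext z
    constructor
    · rintro ⟨hz, x, hx, hxz⟩
      refine ⟨chartAt (Coord n) p x, ⟨(chartAt (Coord n) p).map_source (hp hx), ?_⟩, ?_⟩
      · simpa [(chartAt (Coord n) p).left_inv (hp hx)] using hx
      · rw [inCharts, (chartAt (Coord n) p).left_inv (hp hx), hxz,
          (chartAt (Coord n) q).right_inv hz]
    · rintro ⟨y, hy, rfl⟩
      refine ⟨inCharts_mem_target (hPq y hy), ?_⟩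
      rw [mem_preimage, symm_inCharts (hPq y hy)]
      exact ⟨_, hy.2, rfl⟩
  have hinj : InjOn (inCharts p q α) P := by
    intro y hy z hz hyz
    have h := congrArg (chartAt (Coord n) q).symm hyz
    rw [symm_inCharts (hPq y hy), symm_inCharts (hPq z hz)] at h
    exact (chartAt (Coord n) p).symm.injOn hy.1 hz.1 (α.injective h)
  rw [himg, lintegral_image_eq_lintegral_abs_det_fderiv_mul volume hPm
    (f' := fderiv ℝ (inCharts p q α)) (fun y hy ↦ ((contDiffAt_inCharts hy.1
      (hPq y hy)).differentiableAt (by simp)).hasFDerivAt.hasFDerivWithinAt) hinj]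
  refine setLIntegral_congr_fun hPm fun y hy ↦ ?_
  rw [density_inCharts hα hy.1 (hPq y hy), ENNReal.ofReal_mul (abs_nonneg _),
    det_fderiv_eq_det_jacobian]

variable [SecondCountableTopology M] [Nonempty M]

theorem iUnion_coverSeq : ⋃ k, (chartAt (Coord n) (coverSeq n M k)).source = univ :=
  (exists_coverSeq n M).choose_spec

/-- The volume measure is computed in any chart. -/
theorem volumeMeasure_eq_chartVolume (g : LorentzMetric n M) {A : Set M} (hA : MeasurableSet A)
    (hp : A ⊆ (chartAt (Coord n) p).source) : volumeMeasure g A = chartVolume g p A := by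
  set d : ℕ → Set M := disjointed fun k ↦ (chartAt (Coord n) (coverSeq n M k)).source with hd
  have hdm (k) : MeasurableSet (d k) :=
    MeasurableSet.disjointed (fun k ↦ (chartAt (Coord n) _).open_source.measurableSet) k
  have hdU : ⋃ k, d k = univ := by rw [hd, iUnion_disjointed, iUnion_coverSeq]
  rw [volumeMeasure, Measure.sum_apply _ hA]
  -- Each piece of the glued measure is moved from its own chart to the chart at `p`, using the
  -- identity as isometry.
  have h1 (k) : ((chartVolume g (coverSeq n M k)).restrict (d k)) A =
      chartVolume g p (A ∩ d k) := by
    rw [Measure.restrict_apply hA]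
    have h := chartVolume_image (g := g) (p := p) (q := coverSeq n M k)
      (α := Diffeomorph.refl (𝓡 (n + 1)) M ∞) (isometric_refl g) (hA.inter (hdm k))
      (inter_subset_left.trans hp) (by
        rintro _ ⟨x, hx, rfl⟩
        exact disjointed_subset _ k hx.2)
    simpa using h
  refine (tsum_congr h1).trans ?_
  rw [← measure_iUnion]
  · rw [← inter_iUnion, hdU, inter_univ]
  · intro i j hij
    exact (disjoint_disjointed _ hij).mono inter_subset_right inter_subset_right
  · exact fun k ↦ hA.inter (hdm k)

/-- Isometries preserve the volume measure. -/
theorem measurePreserving_of_isometric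
    (hα : ∀ (x : M) (v w : TangentSpace (𝓡 (n + 1)) x),
      g.inner (α x) (mfderiv (𝓡 (n + 1)) (𝓡 (n + 1)) α x v)
        (mfderiv (𝓡 (n + 1)) (𝓡 (n + 1)) α x w) = g.inner x v w) :
    MeasurePreserving α (volumeMeasure g) (volumeMeasure g) := by
  have hm : Measurable α := α.continuous.measurable
  refine ⟨hm, ?_⟩
  have hcov (x : M) : ∃ k, x ∈ (chartAt (Coord n) (coverSeq n M k)).source := by
    have : x ∈ ⋃ k, (chartAt (Coord n) (coverSeq n M k)).source := by
      rw [iUnion_coverSeq]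
      trivial
    simpa using this
  -- It suffices to compare the measures on sets that lie in one chart and whose preimages under `α`
  -- lie in one chart.
  have hU : ⋃ k : ℕ × ℕ, (chartAt (Coord n) (coverSeq n M k.1)).source ∩
      α.symm ⁻¹' (chartAt (Coord n) (coverSeq n M k.2)).source = univ := by
    refine eq_univ_of_forall fun x ↦ ?_
    obtain ⟨i, hi⟩ := hcov x
    obtain ⟨j, hj⟩ := hcov (α.symm x)
    exact mem_iUnion.2 ⟨(i, j), hi, hj⟩
  refine Measure.ext_of_iUnion_eq_univ hU fun k ↦ Measure.ext fun A hA ↦ ?_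
  rw [Measure.restrict_apply hA, Measure.restrict_apply hA]
  set B := A ∩ ((chartAt (Coord n) (coverSeq n M k.1)).source ∩
      α.symm ⁻¹' (chartAt (Coord n) (coverSeq n M k.2)).source) with hB
  have hBm : MeasurableSet B := hA.inter ((chartAt (Coord n) _).open_source.measurableSet.inter
    (α.symm.continuous.measurable (chartAt (Coord n) _).open_source.measurableSet))
  have himg : α '' (α ⁻¹' B) = B := image_preimage_eq _ α.surjective
  have hsub : α ⁻¹' B ⊆ (chartAt (Coord n) (coverSeq n M k.2)).source := by
    intro x hx
    simpa using hx.2.2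
  have hsub' : B ⊆ (chartAt (Coord n) (coverSeq n M k.1)).source := fun x hx ↦ hx.2.1
  rw [Measure.map_apply hm hBm, volumeMeasure_eq_chartVolume g (hm hBm) hsub,
    volumeMeasure_eq_chartVolume g hBm hsub',
    ← chartVolume_image (q := coverSeq n M k.1) hα (hm hBm) hsub (by rwa [himg]), himg]

/-- The density is bounded near each point. Compact sets therefore have finite volume and continuous
functions are locally integrable. -/
instance isLocallyFiniteMeasure_volumeMeasure (g : LorentzMetric n M) :
    IsLocallyFiniteMeasure (volumeMeasure g) := by
  refine ⟨fun x ↦ ?_⟩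
  have hx := mem_chart_target (Coord n) x
  set y := chartAt (Coord n) x x
  have hev : ∀ᶠ z in 𝓝 y, density g x z < density g x y + 1 :=
    ((continuousOn_density g x).continuousAt
      ((chartAt (Coord n) x).open_target.mem_nhds hx)).eventually_lt continuousAt_const (by simp)
  obtain ⟨ε, hε, hball⟩ := Metric.mem_nhds_iff.1 hev
  set A := (chartAt (Coord n) x).source ∩ chartAt (Coord n) x ⁻¹' Metric.ball y ε with hA
  have hAo : IsOpen A := (chartAt (Coord n) x).isOpen_inter_preimage Metric.isOpen_ball
  refine ⟨A, hAo.mem_nhds ⟨mem_chart_source (Coord n) x, Metric.mem_ball_self hε⟩, ?_⟩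
  rw [volumeMeasure_eq_chartVolume (p := x) g hAo.measurableSet inter_subset_left,
    chartVolume_apply g x hAo.measurableSet]
  have hsub : (chartAt (Coord n) x).target ∩ (chartAt (Coord n) x).symm ⁻¹' A ⊆
      Metric.ball y ε := by
    rintro z ⟨hz, -, hz2⟩
    rwa [mem_preimage, (chartAt (Coord n) x).right_inv hz] at hz2
  calc _ ≤ ∫⁻ z in (chartAt (Coord n) x).target ∩ (chartAt (Coord n) x).symm ⁻¹' A,
        ENNReal.ofReal (density g x y + 1) := by
        refine setLIntegral_mono' (measurableSet_target_inter_preimage x hAo.measurableSet)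
          fun z hz ↦ ENNReal.ofReal_le_ofReal (hball (hsub hz)).le
    _ = ENNReal.ofReal (density g x y + 1) *
        volume ((chartAt (Coord n) x).target ∩ (chartAt (Coord n) x).symm ⁻¹' A) := by
        rw [setLIntegral_const]
    _ < ⊤ := ENNReal.mul_lt_top ENNReal.ofReal_lt_top
        ((measure_mono hsub).trans_lt measure_ball_lt_top)

/-- The density is strictly positive. This lets almost-everywhere equality of continuous functions
be upgraded to equality. -/
instance isOpenPosMeasure_volumeMeasure (g : LorentzMetric n M) :
    (volumeMeasure g).IsOpenPosMeasure := by
  refine ⟨fun U hU ⟨x, hx⟩ h0 ↦ ?_⟩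
  have hAo : IsOpen (U ∩ (chartAt (Coord n) x).source) :=
    hU.inter (chartAt (Coord n) x).open_source
  have h1 : volumeMeasure g (U ∩ (chartAt (Coord n) x).source) = 0 :=
    measure_mono_null inter_subset_left h0
  rw [volumeMeasure_eq_chartVolume (p := x) g hAo.measurableSet inter_subset_right,
    chartVolume_apply g x hAo.measurableSet] at h1
  set V := (chartAt (Coord n) x).target ∩
    (chartAt (Coord n) x).symm ⁻¹' (U ∩ (chartAt (Coord n) x).source)
  have hVo : IsOpen V := (chartAt (Coord n) x).isOpen_inter_preimage_symm hAo
  have hVsub : V ⊆ (chartAt (Coord n) x).target := inter_subset_left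
  have hVne : V.Nonempty := by
    refine ⟨chartAt (Coord n) x x, mem_chart_target (Coord n) x, ?_⟩
    rw [mem_preimage, (chartAt (Coord n) x).left_inv (mem_chart_source (Coord n) x)]
    exact ⟨hx, mem_chart_source (Coord n) x⟩
  have hmeas : AEMeasurable (fun y ↦ ENNReal.ofReal (density g x y)) (volume.restrict V) :=
    (((continuousOn_density g x).mono hVsub).aemeasurable hVo.measurableSet).ennreal_ofReal
  rw [lintegral_eq_zero_iff' hmeas, EventuallyEq, ae_restrict_iff' hVo.measurableSet] at h1
  have h2 : volume V = 0 := by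
    refine measure_mono_null (fun y hy ↦ ?_) (ae_iff.1 h1)
    simp only [mem_ofPred_eq, Classical.not_imp]
    refine ⟨hy, ?_⟩
    simpa using density_pos g (hVsub hy)
  exact (hVo.measure_pos volume hVne).ne' h2

end Volume

/-! ### Causality -/

section Causality

variable {n : ℕ} {M : Type*} [TopologicalSpace M] [ChartedSpace (Coord n) M]
  [IsManifold (𝓡 (n + 1)) ∞ M] {g : LorentzMetric n M} {t : M → ℝ}

/-- A smooth bounded reparametrization of the real line that fixes `0` and `1`. -/
noncomputable def reparam (s : ℝ) : ℝ := Real.arctan s / Real.arctan 1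

theorem reparam_zero : reparam 0 = 0 := by simp [reparam]

theorem reparam_one : reparam 1 = 1 := by
  rw [reparam, div_self]
  simp [Real.pi_ne_zero]

theorem contDiff_reparam : ContDiff ℝ ∞ reparam :=
  Real.contDiff_arctan.div_const _

theorem abs_reparam_le (s : ℝ) : |reparam s| ≤ 2 := by
  have h0 : 0 < Real.arctan 1 := by
    rw [Real.arctan_one]
    positivity
  rw [reparam, abs_div, abs_of_pos h0, div_le_iff₀ h0, Real.arctan_one, abs_le]
  constructor
  · linarith [Real.neg_pi_div_two_lt_arctan s]
  · linarith [Real.arctan_lt_pi_div_two s]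

theorem deriv_reparam_pos (s : ℝ) : 0 < deriv reparam s := by
  have h : HasDerivAt reparam (1 / (1 + s ^ 2) / Real.arctan 1) s :=
    (Real.hasDerivAt_arctan s).div_const _
  rw [h.deriv, Real.arctan_one]
  positivity

theorem dTime_chartDeriv (ht : ContMDiff (𝓡 (n + 1)) 𝓘(ℝ, ℝ) ∞ t) {p : M} {y : Coord n}
    (hy : y ∈ (chartAt (Coord n) p).target) (v : Coord n) :
    dTime t ((chartAt (Coord n) p).symm y) (chartDeriv p y v) =
      fderiv ℝ (t ∘ (chartAt (Coord n) p).symm) y v := by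
  have h := mfderiv_comp y (I := 𝓡 (n + 1)) (I' := 𝓡 (n + 1)) (I'' := 𝓘(ℝ, ℝ)) (g := t)
    (f := (chartAt (Coord n) p).symm) (ht.contMDiffAt.mdifferentiableAt (by simp))
    ((contMDiffAt_chart_symm hy).mdifferentiableAt (by simp))
  rw [mfderiv_eq_fderiv] at h
  exact (congrArg (fun L : Coord n →L[ℝ] ℝ ↦ L v) h).symm

theorem metricForm_chartDeriv (g : LorentzMetric n M) (p : M) (y v : Coord n) :
    metricForm g ((chartAt (Coord n) p).symm y) (chartDeriv p y v) (chartDeriv p y v) =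
      ∑ i, ∑ j, v i * (v j * gram g p y i j) := by
  conv_lhs => rw [coord_eq_sum v]
  simp only [map_sum, map_smul, _root_.sum_apply, _root_.smul_apply, smul_eq_mul, ← gram_apply,
    Finset.mul_sum]
  rw [Finset.sum_comm]
  refine Finset.sum_congr rfl fun i _ ↦ Finset.sum_congr rfl fun j _ ↦ by ring

/-- Around every point, coordinate segments with directions in some open set of vectors are
future-directed causal curves. -/
theorem exists_causalStep_segment (ht : ContMDiff (𝓡 (n + 1)) 𝓘(ℝ, ℝ) ∞ t)
    (hg : ∀ (x : M) (v : TangentSpace (𝓡 (n + 1)) x), v ≠ 0 → 0 ≤ g.inner x v v →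
      dTime t x v ≠ 0) (x : M) :
    ∃ v₀ : Coord n, ∃ δ > 0, ∀ a ∈ Metric.ball (chartAt (Coord n) x x) (δ / 2), ∀ ε > 0,
      ∀ u ∈ Metric.ball v₀ δ, 2 * (ε * ‖u‖) < δ / 2 →
        CausalStep g t ((chartAt (Coord n) x).symm a) ((chartAt (Coord n) x).symm (a + ε • u)) := by
  set ψ := (chartAt (Coord n) x).symm with hψ
  set y₀ := chartAt (Coord n) x x with hy₀
  have hy : y₀ ∈ (chartAt (Coord n) x).target := mem_chart_target (Coord n) x
  -- The time-like vector of an orthonormal frame, with its sign chosen so that `t` increases along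
  -- it.
  obtain ⟨v₀, hQ₀, hT₀⟩ : ∃ v₀ : Coord n, 0 < metricForm g (ψ y₀) (chartDeriv x y₀ v₀)
      (chartDeriv x y₀ v₀) ∧ 0 < fderiv ℝ (t ∘ ψ) y₀ v₀ := by
    obtain ⟨e, he⟩ := g.signature (ψ y₀)
    obtain ⟨v, hv⟩ := (chartDeriv_bijective hy).2 (e 0)
    have h1 : metricForm g (ψ y₀) (chartDeriv x y₀ v) (chartDeriv x y₀ v) = 1 := by
      rw [hv]
      exact (he 0 0).trans (by simp)
    have h2 : fderiv ℝ (t ∘ ψ) y₀ v ≠ 0 := by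
      rw [← dTime_chartDeriv ht hy, hv]
      exact hg _ _ (e.ne_zero 0) (zero_le_one.trans_eq ((he 0 0).trans (by simp)).symm)
    rcases h2.lt_or_gt with h | h
    · refine ⟨-v, ?_, by simpa using h⟩
      simp [h1]
    · exact ⟨v, by simp [h1], h⟩
  have hQc : ContinuousAt (fun z : Coord n × Coord n ↦
      ∑ i, ∑ j, z.2 i * (z.2 j * gram g x z.1 i j)) (y₀, v₀) := by
    refine tendsto_finsetSum _ fun i _ ↦ tendsto_finsetSum _ fun j _ ↦ ?_
    have h1 (i : Fin (n + 1)) : ContinuousAt (fun z : Coord n × Coord n ↦ z.2 i) (y₀, v₀) := by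
      fun_prop
    have h2 : ContinuousAt (fun z : Coord n × Coord n ↦ gram g x z.1 i j) (y₀, v₀) :=
      ContinuousAt.comp (g := fun y ↦ gram g x y i j) (contDiffAt_gram g hy i j).continuousAt
        continuousAt_fst
    exact (h1 i).mul ((h1 j).mul h2)
  have hTc : ContinuousAt (fun z : Coord n × Coord n ↦ fderiv ℝ (t ∘ ψ) z.1 z.2) (y₀, v₀) := by
    have h1 : ContDiffAt ℝ ∞ (t ∘ ψ) y₀ :=
      (ht.contMDiffAt.comp y₀ (contMDiffAt_chart_symm hy)).contDiffAt
    have h2 : ContinuousAt (fderiv ℝ (t ∘ ψ)) y₀ :=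
      (h1.fderiv_right (m := ∞) (by simp)).continuousAt
    exact (ContinuousAt.comp (f := Prod.fst) (x := (y₀, v₀)) h2 continuousAt_fst).clm_apply
      continuousAt_snd
  -- Strict time-likeness and strict increase of `t` are open conditions on the pair of base point
  -- and direction.
  have hev : ∀ᶠ z : Coord n × Coord n in 𝓝 (y₀, v₀), z.1 ∈ (chartAt (Coord n) x).target ∧
      0 < ∑ i, ∑ j, z.2 i * (z.2 j * gram g x z.1 i j) ∧ 0 < fderiv ℝ (t ∘ ψ) z.1 z.2 := by
    refine (continuousAt_fst.eventually ((chartAt (Coord n) x).open_target.mem_nhds hy)).and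
      ((hQc.eventually (lt_mem_nhds ?_)).and (hTc.eventually (lt_mem_nhds hT₀)))
    rw [metricForm_chartDeriv] at hQ₀
    exact hQ₀
  obtain ⟨δ, hδ, hball⟩ := Metric.eventually_nhds_iff_ball.1 hev
  refine ⟨v₀, δ, hδ, fun a ha ε hε u hu hεu ↦ ?_⟩
  -- A causal step needs a curve smooth on all of `ℝ`, and a straight line would leave the chart.
  -- Since `|reparam| ≤ 2`, this curve stays in the ball of radius `δ` for every `s`.
  set c : ℝ → Coord n := fun s ↦ a + (reparam s * ε) • u with hc
  have hcball (s : ℝ) : c s ∈ Metric.ball y₀ δ := by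
    rw [Metric.mem_ball, dist_eq_norm] at ha ⊢
    have h1 : c s - y₀ = (a - y₀) + (reparam s * ε) • u := by
      simp only [hc]
      abel
    have h2 : ‖(reparam s * ε) • u‖ ≤ 2 * (ε * ‖u‖) := by
      rw [norm_smul, Real.norm_eq_abs, abs_mul, abs_of_pos hε, mul_assoc]
      exact mul_le_mul_of_nonneg_right (abs_reparam_le s) (by positivity)
    rw [h1]
    linarith [norm_add_le (a - y₀) ((reparam s * ε) • u)]
  have hcu (s : ℝ) := hball (c s, u) (by
    rw [← ball_prod_same]
    exact ⟨hcball s, hu⟩)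
  have hcd (s : ℝ) : HasFDerivAt c
      (ContinuousLinearMap.toSpanSingleton ℝ ((deriv reparam s * ε) • u)) s :=
    (((((contDiff_reparam.differentiable (by simp)) s).hasDerivAt.mul_const ε).smul_const
      u).const_add a).hasFDerivAt
  have hcs : ContDiff ℝ ∞ c :=
    contDiff_const.add ((contDiff_reparam.mul contDiff_const).smul contDiff_const)
  refine ⟨ψ ∘ c, fun s ↦ ?_, ?_, ?_, fun s _ ↦ ?_⟩
  · exact (contMDiffAt_chart_symm (hcu s).1).comp s hcs.contDiffAt.contMDiffAt
  · simp [hc, reparam_zero]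
  · simp [hc, reparam_one]
  · have h1 : mfderiv 𝓘(ℝ, ℝ) (𝓡 (n + 1)) (ψ ∘ c) s (1 : ℝ) =
        chartDeriv x (c s) ((deriv reparam s * ε) • u) := by
      have h := mfderiv_comp s (I := 𝓘(ℝ, ℝ)) (I' := 𝓡 (n + 1)) (I'' := 𝓡 (n + 1)) (g := ψ)
        (f := c) ((contMDiffAt_chart_symm (hcu s).1).mdifferentiableAt (by simp))
        (hcd s).differentiableAt.mdifferentiableAt
      rw [mfderiv_eq_fderiv, (hcd s).fderiv] at h
      have h2 := congrArg (fun L : ℝ →L[ℝ] Coord n ↦ L 1) h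
      refine h2.trans ?_
      change chartDeriv x (c s) (ContinuousLinearMap.toSpanSingleton ℝ _ 1) = _
      rw [ContinuousLinearMap.toSpanSingleton_apply, one_smul]
    have hpos : 0 < deriv reparam s * ε := mul_pos (deriv_reparam_pos s) hε
    rw [h1]
    constructor
    · change 0 ≤ metricForm g (ψ (c s)) (chartDeriv x (c s) ((deriv reparam s * ε) • u))
        (chartDeriv x (c s) ((deriv reparam s * ε) • u))
      rw [map_smul, map_smul, map_smul, _root_.smul_apply, metricForm_chartDeriv]
      exact smul_nonneg hpos.le (smul_nonneg hpos.le (hcu s).2.1.le)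
    · change 0 < dTime t (ψ (c s)) (chartDeriv x (c s) ((deriv reparam s * ε) • u))
      rw [dTime_chartDeriv ht (hcu s).1, map_smul]
      exact smul_pos hpos (hcu s).2.2

/-- Every point has a neighbourhood in the future of a single point and in the past of a single
point. -/
theorem exists_eventually_causalLE (ht : ContMDiff (𝓡 (n + 1)) 𝓘(ℝ, ℝ) ∞ t)
    (hg : ∀ (x : M) (v : TangentSpace (𝓡 (n + 1)) x), v ≠ 0 → 0 ≤ g.inner x v v →
      dTime t x v ≠ 0) (x : M) :
    ∃ p q : M, ∀ᶠ z in 𝓝 x, CausalLE g t p z ∧ CausalLE g t z q := by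
  obtain ⟨v₀, δ, hδ, h⟩ := exists_causalStep_segment ht hg x
  set y₀ := chartAt (Coord n) x x with hy₀
  -- With `X = ‖v₀‖ + δ` the choice `ε = δ / (4X + 1)` gives `2εX < δ/2`; the `+ 1` makes the
  -- inequality strict.
  obtain ⟨ε, hε, hε1⟩ : ∃ ε > 0, 2 * (ε * (‖v₀‖ + δ)) < δ / 2 := by
    refine ⟨δ / (4 * (‖v₀‖ + δ) + 1), by positivity, ?_⟩
    have h0 := norm_nonneg v₀
    rw [div_mul_eq_mul_div, mul_div_assoc', div_lt_div_iff₀ (by positivity) (by norm_num)]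
    nlinarith
  refine ⟨(chartAt (Coord n) x).symm (y₀ - ε • v₀), (chartAt (Coord n) x).symm (y₀ + ε • v₀), ?_⟩
  -- The segments joining `y₀ - ε v₀` to `y` and `y` to `y₀ + ε v₀` have directions `v₀ ± ε⁻¹ (y -
  -- y₀)`, which are within `δ` of `v₀` once `‖y - y₀‖ < ε δ`.
  have hev : ∀ᶠ z in 𝓝 x, chartAt (Coord n) x z ∈ Metric.ball y₀ (min (ε * δ) (δ / 2)) :=
    (contMDiffAt_chart (mem_chart_source (Coord n) x)).continuousAt.eventually
      (Metric.ball_mem_nhds _ (by positivity))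
  filter_upwards [hev, chart_source_mem_nhds (Coord n) x] with z hz hzs
  set y := chartAt (Coord n) x z with hy
  have hzy : (chartAt (Coord n) x).symm y = z := (chartAt (Coord n) x).left_inv hzs
  rw [Metric.mem_ball, lt_min_iff, dist_eq_norm] at hz
  have hnorm : ‖ε⁻¹ • (y - y₀)‖ < δ := by
    rw [norm_smul, norm_inv, Real.norm_of_nonneg hε.le, inv_mul_lt_iff₀ hε]
    exact hz.1
  have hsmall (u : Coord n) (hu : u ∈ Metric.ball v₀ δ) : 2 * (ε * ‖u‖) < δ / 2 := by
    refine lt_of_le_of_lt ?_ hε1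
    rw [Metric.mem_ball, dist_eq_norm] at hu
    have : ‖u‖ ≤ ‖v₀‖ + δ := by
      have := norm_add_le v₀ (u - v₀)
      rw [add_sub_cancel] at this
      linarith
    gcongr
  constructor
  · have hu : v₀ + ε⁻¹ • (y - y₀) ∈ Metric.ball v₀ δ := by
      simpa [Metric.mem_ball, dist_eq_norm] using hnorm
    have ha : y₀ - ε • v₀ ∈ Metric.ball y₀ (δ / 2) := by
      have := hsmall v₀ (Metric.mem_ball_self hδ)
      rw [Metric.mem_ball, dist_eq_norm, sub_sub_cancel_left, norm_neg, norm_smul,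
        Real.norm_of_nonneg hε.le]
      have h0 : 0 ≤ ε * ‖v₀‖ := by positivity
      linarith
    have := h _ ha ε hε _ hu (hsmall _ hu)
    rw [smul_add, smul_inv_smul₀ hε.ne', show y₀ - ε • v₀ + (ε • v₀ + (y - y₀)) = y by abel,
      hzy] at this
    exact Relation.ReflTransGen.single this
  · have hu : v₀ - ε⁻¹ • (y - y₀) ∈ Metric.ball v₀ δ := by
      simpa [Metric.mem_ball, dist_eq_norm] using hnorm
    have ha : y ∈ Metric.ball y₀ (δ / 2) := by
      rw [Metric.mem_ball, dist_eq_norm]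
      exact hz.2
    have := h _ ha ε hε _ hu (hsmall _ hu)
    rw [smul_sub, smul_inv_smul₀ hε.ne', show y + (ε • v₀ - (y - y₀)) = y₀ + ε • v₀ by abel,
      hzy] at this
    exact Relation.ReflTransGen.single this

/-- The intersection of the causal past and the causal future of a compact set is relatively
compact. -/
theorem exists_isCompact_causalPast_inter_causalFuture
    (ht : ContMDiff (𝓡 (n + 1)) 𝓘(ℝ, ℝ) ∞ t) (hg : IsGloballyHyperbolic g t) {K : Set M}
    (hK : IsCompact K) : ∃ C, IsCompact C ∧ causalPast g t K ∩ causalFuture g t K ⊆ C := by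
  -- A point `z` with `x' ≤ z ≤ x` and `x, x' ∈ K` satisfies `p i ≤ x' ≤ z ≤ x ≤ q j` for indices
  -- from a finite subcover, so finitely many diamonds suffice.
  choose p q hpq using exists_eventually_causalLE ht hg.temporal
  obtain ⟨s, -, hs⟩ := hK.elim_nhds_subcover _ fun x _ ↦ hpq x
  refine ⟨⋃ i ∈ s, ⋃ j ∈ s, {z | CausalLE g t (p i) z ∧ CausalLE g t z (q j)},
    s.isCompact_biUnion fun i _ ↦ s.isCompact_biUnion fun j _ ↦ hg.diamond _ _, ?_⟩
  rintro z ⟨⟨x, hx, hzx⟩, ⟨x', hx', hxz⟩⟩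
  obtain ⟨i, hi, hi'⟩ := mem_iUnion₂.1 (hs hx')
  obtain ⟨j, hj, hj'⟩ := mem_iUnion₂.1 (hs hx)
  exact mem_biUnion hi (mem_biUnion hj ⟨hi'.1.trans hxz, hzx.trans hj'.2⟩)

theorem CausalLE.map {α : M ≃ₘ^∞⟮𝓡 (n + 1), 𝓡 (n + 1)⟯ M} (hα : IsOrthochronousIsometry g t α)
    {x y : M} (h : CausalLE g t x y) : CausalLE g t (α x) (α y) := by
  refine Relation.ReflTransGen.lift α (fun a b ↦ ?_) _ _ h
  rintro ⟨γ, hγ, rfl, rfl, hc⟩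
  refine ⟨α ∘ γ, α.contMDiff.comp hγ, rfl, rfl, fun s hs ↦ ?_⟩
  have h := mfderiv_comp s (I := 𝓘(ℝ, ℝ)) (I' := 𝓡 (n + 1)) (I'' := 𝓡 (n + 1)) (g := α)
    (f := γ) (α.contMDiff.contMDiffAt.mdifferentiableAt (by simp))
    (hγ.contMDiffAt.mdifferentiableAt (by simp))
  rw [h]
  exact hα.orientation _ _ (hc s hs)

theorem contMDiff_timeOf {S : Type*} [TopologicalSpace S]
    [ChartedSpace (EuclideanSpace ℝ (Fin n)) S]
    (Φ : M ≃ₘ^∞⟮𝓡 (n + 1), (𝓘(ℝ, ℝ)).prod (𝓡 n)⟯ (ℝ × S)) :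
    ContMDiff (𝓡 (n + 1)) 𝓘(ℝ, ℝ) ∞ (timeOf Φ) :=
  contMDiff_fst.comp Φ.contMDiff

end Causality

section Distributions

variable {n : ℕ} {M : Type*} [TopologicalSpace M] [T2Space M] [SecondCountableTopology M]
  [Nonempty M] [ChartedSpace (Coord n) M] [IsManifold (𝓡 (n + 1)) ∞ M]
  [MeasurableSpace M] [BorelSpace M] {g : LorentzMetric n M} {t : M → ℝ} {m : ℝ}
  {Gr Ga Dp : (M → ℂ) → M → ℂ}

/-! ### Locally integrable functions and test functions -/

theorem integrable_mul_test {μ : Measure M} {u φ : M → ℂ} (hu : LocallyIntegrable u μ)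
    (hφ : IsTest n φ) : Integrable (fun y ↦ u y * φ y) μ := by
  have h := hu.integrable_smul_left_of_hasCompactSupport hφ.1.continuous hφ.2
  simpa only [smul_eq_mul, mul_comm] using h

/-- Locally integrable functions that define the same distribution agree almost everywhere. -/
theorem ae_eq_of_integral_mul_test {u v : M → ℂ} (hu : LocallyIntegrable u (volumeMeasure g))
    (hv : LocallyIntegrable v (volumeMeasure g))
    (h : ∀ φ, IsTest n φ →
      ∫ y, u y * φ y ∂(volumeMeasure g) = ∫ y, v y * φ y ∂(volumeMeasure g)) :
    u =ᵐ[volumeMeasure g] v := by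
  have : LocallyCompactSpace M := ChartedSpace.locallyCompactSpace (Coord n) M
  refine ae_eq_of_integral_contMDiff_smul_eq (𝓡 (n + 1)) hu hv fun φ hφ hφc ↦ ?_
  have := h (fun y ↦ (φ y : ℂ)) ⟨Complex.ofRealCLM.contDiff.contMDiff.comp hφ,
    hφc.comp_left (g := fun r : ℝ ↦ (r : ℂ)) Complex.ofReal_zero⟩
  simpa only [Complex.real_smul, mul_comm] using this

theorem locallyIntegrable_bar {μ : Measure M} {u : M → ℂ} (hu : LocallyIntegrable u μ) :
    LocallyIntegrable (bar u) μ := fun x ↦ by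
  obtain ⟨s, hs, h⟩ := hu x
  exact ⟨s, hs, Complex.conjCLE.toContinuousLinearMap.integrable_comp h⟩

/-- Inverses of isometries preserve the volume. -/
theorem measurePreserving_symm {α : M ≃ₘ^∞⟮𝓡 (n + 1), 𝓡 (n + 1)⟯ M}
    (hα : IsOrthochronousIsometry g t α) :
    MeasurePreserving α.symm (volumeMeasure g) (volumeMeasure g) :=
  (measurePreserving_of_isometric hα.isometric).symm α.toHomeomorph.toMeasurableEquiv

theorem integral_comp_isometry {α : M ≃ₘ^∞⟮𝓡 (n + 1), 𝓡 (n + 1)⟯ M}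
    (hα : IsOrthochronousIsometry g t α) (F : M → ℂ) :
    ∫ y, F (α.symm y) ∂(volumeMeasure g) = ∫ y, F y ∂(volumeMeasure g) :=
  (measurePreserving_symm hα).integral_comp
    α.symm.toHomeomorph.toMeasurableEquiv.measurableEmbedding F

theorem locallyIntegrable_comp_isometry {α : M ≃ₘ^∞⟮𝓡 (n + 1), 𝓡 (n + 1)⟯ M}
    (hα : IsOrthochronousIsometry g t α) {u : M → ℂ}
    (hu : LocallyIntegrable u (volumeMeasure g)) :
    LocallyIntegrable (u ∘ α.symm) (volumeMeasure g) := fun x ↦ by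
  obtain ⟨s, hs, h⟩ := hu (α.symm x)
  refine ⟨α.symm ⁻¹' s, α.symm.continuous.continuousAt hs, ?_⟩
  exact ((measurePreserving_symm hα).integrableOn_comp_preimage
    α.symm.toHomeomorph.toMeasurableEquiv.measurableEmbedding).2 h

theorem isTest_comp {f : M → ℂ} (hf : IsTest n f) (α : M ≃ₘ^∞⟮𝓡 (n + 1), 𝓡 (n + 1)⟯ M) :
    IsTest n (f ∘ α) :=
  ⟨hf.1.comp α.contMDiff, hf.2.comp_homeomorph α.toHomeomorph⟩

theorem IsFundamentalSolution.continuous {cone : Set M → Set M} {G : (M → ℂ) → M → ℂ}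
    (hG : IsFundamentalSolution g m cone G) {f : M → ℂ} (hf : IsTest n f) : Continuous (G f) :=
  (hG.smooth f hf).continuous

/-- The commutator function is the imaginary part of `D⁺`, as functions. -/
theorem IsTwoPoint.sub_minusFn_ae (hGr : IsRetarded g t m Gr) (hGa : IsAdvanced g t m Ga)
    (hDp : IsTwoPoint g t m Gr Ga Dp) {f : M → ℂ} (hf : IsTest n f) :
    (fun y ↦ Dp f y - minusFn Dp f y) =ᵐ[volumeMeasure g]
      fun y ↦ 2 * Complex.I * (Gr f y - Ga f y) := by
  have h1 := hDp.bidistribution.locallyIntegrable f hf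
  have h2 : LocallyIntegrable (minusFn Dp f) (volumeMeasure g) :=
    locallyIntegrable_bar (hDp.bidistribution.locallyIntegrable _ (isTest_bar hf))
  have h3 : Continuous fun y ↦ 2 * Complex.I * (Gr f y - Ga f y) :=
    continuous_const.mul ((hGr.continuous hf).sub (hGa.continuous hf))
  refine ae_eq_of_integral_mul_test (h1.sub h2) h3.locallyIntegrable fun φ hφ ↦ ?_
  have h4 := hDp.imaginary f φ hf hφ
  simp only [pair] at h4
  rw [← integral_sub (integrable_mul_test h1 hφ) (integrable_mul_test h2 hφ),
    ← integral_const_mul] at h4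
  simpa only [sub_mul, mul_assoc, commutatorFn] using h4

/-- A point after some `b ∈ B` and before some `a ∈ A` would give `b ≤ a`. -/
theorem not_spacelike_of_causal {A B : Set M} (h : ∀ x ∈ A, ∀ y ∈ B, Spacelike g t x y) {y : M}
    (hA : y ∈ causalPast g t A) (hB : y ∈ causalFuture g t B) : False := by
  obtain ⟨a, ha, hya⟩ := hA
  obtain ⟨b, hb, hby⟩ := hB
  exact (h a ha b hb).2 (hby.trans hya)

theorem IsRetarded.mem_causalPast (hGr : IsRetarded g t m Gr) {f : M → ℂ} (hf : IsTest n f)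
    {y : M} (hy : Gr f y ≠ 0) : y ∈ causalPast g t (tsupport f) :=
  hGr.support f hf (subset_tsupport _ hy)

theorem IsAdvanced.mem_causalFuture (hGa : IsAdvanced g t m Ga) {f : M → ℂ} (hf : IsTest n f)
    {y : M} (hy : Ga f y ≠ 0) : y ∈ causalFuture g t (tsupport f) :=
  hGa.support f hf (subset_tsupport _ hy)

/-! ### Invariance of the fundamental solutions -/

theorem IsFundamentalSolution.apply_kleinGordon_ae {cone : Set M → Set M}
    {G : (M → ℂ) → M → ℂ} (hG : IsFundamentalSolution g m cone G) {f : M → ℂ}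
    (hf : IsTest n f) : G (kleinGordon g m f) =ᵐ[volumeMeasure g] f :=
  ae_eq_of_integral_mul_test
    (hG.bidistribution.locallyIntegrable _ (isTest_kleinGordon g m hf))
    hf.1.continuous.locallyIntegrable fun φ hφ ↦ hG.left f φ hf hφ

/-- The Klein-Gordon operator is symmetric, as it has a two-sided fundamental solution. -/
theorem IsFundamentalSolution.integral_mul_kleinGordon {cone : Set M → Set M}
    {G : (M → ℂ) → M → ℂ} (hG : IsFundamentalSolution g m cone G) {f h : M → ℂ}
    (hf : IsTest n f) (hh : IsTest n h) :
    ∫ y, f y * kleinGordon g m h y ∂(volumeMeasure g) =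
      ∫ y, kleinGordon g m f y * h y ∂(volumeMeasure g) := by
  -- With `K` the Klein-Gordon operator, `∫ Kf · h = ∫ G(Kf) · Kh`, and `G(Kf) = f` almost
  -- everywhere.
  rw [← hG.right _ h (isTest_kleinGordon g m hf) hh, pair]
  refine integral_congr_ae ?_
  filter_upwards [hG.apply_kleinGordon_ae hf] with y hy
  rw [hy]

/-- A test function that solves the Klein-Gordon equation weakly vanishes. -/
theorem IsFundamentalSolution.eq_zero_of_weak_solution {cone : Set M → Set M}
    {G : (M → ℂ) → M → ℂ} (hG : IsFundamentalSolution g m cone G) {u : M → ℂ}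
    (hu : IsTest n u)
    (h : ∀ φ, IsTest n φ → ∫ y, u y * kleinGordon g m φ y ∂(volumeMeasure g) = 0) : u = 0 := by
  have hK := isTest_kleinGordon g m hu
  have hK0 : kleinGordon g m u = 0 := by
    refine (Continuous.ae_eq_iff_eq (volumeMeasure g) hK.1.continuous continuous_zero).1 ?_
    refine ae_eq_of_integral_mul_test hK.1.continuous.locallyIntegrable
      continuous_zero.locallyIntegrable fun φ hφ ↦ ?_
    rw [← hG.integral_mul_kleinGordon hu hφ, h φ hφ]
    simp
  refine (Continuous.ae_eq_iff_eq (volumeMeasure g) hu.1.continuous continuous_zero).1 ?_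
  refine ae_eq_of_integral_mul_test hu.1.continuous.locallyIntegrable
    continuous_zero.locallyIntegrable fun φ hφ ↦ ?_
  -- Weakly `u = G(Ku) = G(0)`. Linearity of `G` is available only after pairing, so `G(0)` is
  -- treated as `G(0 • u)`.
  have h1 := hG.bidistribution.smul 0 u φ hu hφ
  rw [← hG.left u φ hu hφ, hK0, ← zero_smul ℂ u, h1]
  simp

theorem IsTwoPoint.apply_comp_ae (hDp : IsTwoPoint g t m Gr Ga Dp)
    {α : M ≃ₘ^∞⟮𝓡 (n + 1), 𝓡 (n + 1)⟯ M} (hα : IsOrthochronousIsometry g t α) {f : M → ℂ}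
    (hf : IsTest n f) : Dp (f ∘ α.symm) =ᵐ[volumeMeasure g] Dp f ∘ α.symm := by
  refine ae_eq_of_integral_mul_test
    (hDp.bidistribution.locallyIntegrable _ (isTest_comp hf α.symm))
    (locallyIntegrable_comp_isometry hα (hDp.bidistribution.locallyIntegrable f hf))
    fun φ hφ ↦ ?_
  have h := hDp.invariant α hα f (φ ∘ α) hf (isTest_comp hφ α)
  have h1 : (φ ∘ α) ∘ α.symm = φ := by
    funext x
    simp
  rw [h1] at h
  simp only [pair] at h
  rw [h, ← integral_comp_isometry hα]
  simp

theorem IsTwoPoint.minusFn_comp_ae (hDp : IsTwoPoint g t m Gr Ga Dp)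
    {α : M ≃ₘ^∞⟮𝓡 (n + 1), 𝓡 (n + 1)⟯ M} (hα : IsOrthochronousIsometry g t α) {f : M → ℂ}
    (hf : IsTest n f) :
    minusFn Dp (f ∘ α.symm) =ᵐ[volumeMeasure g] minusFn Dp f ∘ α.symm := by
  filter_upwards [hDp.apply_comp_ae hα (isTest_bar hf)] with y hy
  exact congrArg (starRingEnd ℂ) hy

theorem mem_tsupport_comp {f : M → ℂ} (α : M ≃ₘ^∞⟮𝓡 (n + 1), 𝓡 (n + 1)⟯ M) {z : M}
    (hz : z ∈ tsupport f) : α z ∈ tsupport (f ∘ α.symm) := by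
  have h := tsupport_comp_eq_preimage f α.symm.toHomeomorph
  have h' : tsupport (f ∘ α.symm) = α.symm ⁻¹' tsupport f := h
  rw [h', mem_preimage, Diffeomorph.symm_apply_apply]
  exact hz

/-- The retarded fundamental solution is invariant under isometries. -/
theorem retarded_comp (ht : ContMDiff (𝓡 (n + 1)) 𝓘(ℝ, ℝ) ∞ t) (hM : IsGloballyHyperbolic g t)
    (hGr : IsRetarded g t m Gr) (hGa : IsAdvanced g t m Ga) (hDp : IsTwoPoint g t m Gr Ga Dp)
    {α : M ≃ₘ^∞⟮𝓡 (n + 1), 𝓡 (n + 1)⟯ M} (hα : IsOrthochronousIsometry g t α) {f : M → ℂ}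
    (hf : IsTest n f) : Gr (f ∘ α.symm) = Gr f ∘ α.symm := by
  have hfα := isTest_comp hf α.symm
  have hr := hGr.continuous hf
  have ha := hGa.continuous hf
  have hrα := hGr.continuous hfα
  have haα := hGa.continuous hfα
  -- The commutator function is determined by `D⁺`, hence invariant almost everywhere, and
  -- everywhere by continuity.
  have hcomm : (fun y ↦ Gr (f ∘ α.symm) y - Ga (f ∘ α.symm) y) =
      fun y ↦ Gr f (α.symm y) - Ga f (α.symm y) := by
    refine (Continuous.ae_eq_iff_eq (volumeMeasure g) (hrα.sub haα)
      ((hr.comp α.symm.continuous).sub (ha.comp α.symm.continuous))).1 ?_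
    have h0 := (measurePreserving_symm hα).quasiMeasurePreserving.ae_eq_comp
      (hDp.sub_minusFn_ae hGr hGa hf)
    filter_upwards [h0, hDp.sub_minusFn_ae hGr hGa hfα, hDp.apply_comp_ae hα hf,
      hDp.minusFn_comp_ae hα hf] with y h1 h2 h3 h4
    simp only [Function.comp_apply] at h1 h2 h3 h4
    rw [h3, h4, h1] at h2
    exact (mul_left_cancel₀ (by simp) h2).symm
  set u : M → ℂ := fun y ↦ Gr (f ∘ α.symm) y - Gr f (α.symm y) with hu
  -- Invariance of `G_r - G_a` makes the advanced defect equal to the retarded one, so both support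
  -- properties apply to `u`.
  have hu' (y : M) : u y = Ga (f ∘ α.symm) y - Ga f (α.symm y) := by
    have h : Gr (f ∘ α.symm) y - Ga (f ∘ α.symm) y = Gr f (α.symm y) - Ga f (α.symm y) :=
      congrFun hcomm y
    simp only [hu]
    linear_combination h
  have hpast (y : M) (hy : u y ≠ 0) : y ∈ causalPast g t (tsupport (f ∘ α.symm)) := by
    by_cases h : Gr (f ∘ α.symm) y = 0
    · have h1 : Gr f (α.symm y) ≠ 0 := by
        intro h1
        simp [hu, h, h1] at hy
      obtain ⟨z, hz, hzy⟩ := hGr.mem_causalPast hf h1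
      refine ⟨α z, mem_tsupport_comp α hz, ?_⟩
      simpa using hzy.map hα
    · exact hGr.mem_causalPast hfα h
  have hfuture (y : M) (hy : u y ≠ 0) : y ∈ causalFuture g t (tsupport (f ∘ α.symm)) := by
    by_cases h : Ga (f ∘ α.symm) y = 0
    · have h1 : Ga f (α.symm y) ≠ 0 := by
        intro h1
        simp [hu', h, h1] at hy
      obtain ⟨z, hz, hzy⟩ := hGa.mem_causalFuture hf h1
      refine ⟨α z, mem_tsupport_comp α hz, ?_⟩
      simpa using hzy.map hα
    · exact hGa.mem_causalFuture hfα h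
  obtain ⟨C, hC, hsub⟩ := exists_isCompact_causalPast_inter_causalFuture ht hM hfα.2
  have hrm : ContMDiff (𝓡 (n + 1)) 𝓘(ℝ, ℂ) ∞ fun y ↦ Gr f (α.symm y) :=
    (hGr.smooth f hf).comp α.symm.contMDiff
  have hut : IsTest n u := ⟨(hGr.smooth _ hfα).sub hrm,
    HasCompactSupport.of_support_subset_isCompact hC fun y hy ↦ hsub ⟨hpast y hy, hfuture y hy⟩⟩
  have hu0 : u = 0 := by
    -- Both `G_r(f ∘ α⁻¹, ·)` and `G_r(f, ·) ∘ α⁻¹` solve the equation weakly with source `f ∘ α⁻¹`;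
    -- for the second, the test function is pulled back by `α`.
    refine hGr.eq_zero_of_weak_solution hut fun φ hφ ↦ ?_
    have hK := isTest_kleinGordon g m hφ
    have h1 : ∫ y, Gr (f ∘ α.symm) y * kleinGordon g m φ y ∂(volumeMeasure g) =
      ∫ y, (f ∘ α.symm) y * φ y ∂(volumeMeasure g) := hGr.right _ φ hfα hφ
    have h2 : ∫ y, Gr f y * kleinGordon g m (φ ∘ α) y ∂(volumeMeasure g) =
      ∫ y, f y * (φ ∘ α) y ∂(volumeMeasure g) := hGr.right f _ hf (isTest_comp hφ α)
    rw [kleinGordon_comp hα.isometric m hφ.1, ← integral_comp_isometry hα,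
      ← integral_comp_isometry hα (fun y ↦ f y * (φ ∘ α) y)] at h2
    simp only [Function.comp_apply, Diffeomorph.apply_symm_apply] at h1 h2
    simp only [hu, sub_mul]
    rw [integral_sub (integrable_mul_test hrα.locallyIntegrable hK)
      (integrable_mul_test hrm.continuous.locallyIntegrable hK)]
    rw [h2, sub_eq_zero]
    exact h1
  funext y
  exact sub_eq_zero.1 (congrFun hu0 y)

/-! ### Integrability -/

theorem DispersionCondition.memLp (hDp : IsTwoPoint g t m Gr Ga Dp) {N : ℕ} (hN : N ≠ 0)
    (hd : DispersionCondition g Dp N) {f : M → ℂ} (hf : IsTest n f) :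
    MemLp (Dp f) N (volumeMeasure g) := by
  refine (integrable_norm_rpow_iff (hDp.measurable f hf).aestronglyMeasurable (by simpa using hN)
    (by simp)).1 ?_
  simpa using hd.integrable f hf

theorem DispersionCondition.memLp_minusFn (hDp : IsTwoPoint g t m Gr Ga Dp) {N : ℕ}
    (hN : N ≠ 0) (hd : DispersionCondition g Dp N) {f : M → ℂ} (hf : IsTest n f) :
    MemLp (minusFn Dp f) N (volumeMeasure g) :=
  Complex.conjCLE.toContinuousLinearMap.comp_memLp' (hd.memLp hDp hN (isTest_bar hf))

/-- `G_r` is dominated by `|D⁺| + |D⁻|` plus a constant on a compact set `C`. Outside `C`, at least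
one of `G_r` and `G_a` vanishes; where `G_r` does not, `2i G_r = D⁺ - D⁻`. -/
theorem DispersionCondition.memLp_retarded (ht : ContMDiff (𝓡 (n + 1)) 𝓘(ℝ, ℝ) ∞ t)
    (hM : IsGloballyHyperbolic g t) (hGr : IsRetarded g t m Gr) (hGa : IsAdvanced g t m Ga)
    (hDp : IsTwoPoint g t m Gr Ga Dp) {N : ℕ} (hN : N ≠ 0) (hd : DispersionCondition g Dp N)
    {f : M → ℂ} (hf : IsTest n f) : MemLp (Gr f) N (volumeMeasure g) := by
  obtain ⟨C, hC, hsub⟩ := exists_isCompact_causalPast_inter_causalFuture ht hM hf.2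
  obtain ⟨B, hB⟩ := hC.exists_bound_of_continuousOn (hGr.continuous hf).continuousOn
  have h1 := ((hd.memLp hDp hN hf).norm.add (hd.memLp_minusFn hDp hN hf).norm).add
    (memLp_indicator_const (N : ENNReal) hC.measurableSet B (Or.inr hC.measure_lt_top.ne))
  refine h1.mono' (hGr.continuous hf).aestronglyMeasurable ?_
  filter_upwards [hDp.sub_minusFn_ae hGr hGa hf] with y hy
  simp only [Pi.add_apply]
  by_cases hyC : y ∈ C
  · rw [indicator_of_mem hyC]
    have := hB y hyC
    have := norm_nonneg (Dp f y)
    have := norm_nonneg (minusFn Dp f y)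
    linarith
  · rw [indicator_of_notMem hyC, add_zero]
    by_cases hr : Gr f y = 0
    · rw [hr, norm_zero]
      positivity
    · have ha : Ga f y = 0 := by
        by_contra ha
        exact hyC (hsub ⟨hGr.mem_causalPast hf hr, hGa.mem_causalFuture hf ha⟩)
      rw [ha, sub_zero] at hy
      have h2 : 2 * ‖Gr f y‖ = ‖Dp f y - minusFn Dp f y‖ := by
        rw [hy]
        simp
      have := norm_sub_le (Dp f y) (minusFn Dp f y)
      have := norm_nonneg (Gr f y)
      linarith

/-- A single product over all `N` indices is the shape to which the generalized Hölder inequality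
applies. -/
theorem vertexIntegrand_eq_prod {N : ℕ} (f : Fin N → M → ℂ) (k : Fin N) (y : M) :
    vertexIntegrand Gr Dp f k y = ∏ l, (if l < k then minusFn Dp (f l) y else
      if l = k then Gr (f l) y else Dp (f l) y) := by
  rw [Fintype.prod_eq_mul_prod_compl k, ← Finset.Ioi_disjUnion_Iio k, Finset.prod_disjUnion]
  have h1 : ∏ l ∈ Finset.Ioi k, (if l < k then minusFn Dp (f l) y else
      if l = k then Gr (f l) y else Dp (f l) y) = ∏ l ∈ Finset.Ioi k, Dp (f l) y :=
    Finset.prod_congr rfl fun l hl ↦ by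
      rw [Finset.mem_Ioi] at hl
      rw [if_neg hl.not_gt, if_neg hl.ne']
  have h2 : ∏ l ∈ Finset.Iio k, (if l < k then minusFn Dp (f l) y else
      if l = k then Gr (f l) y else Dp (f l) y) = ∏ l ∈ Finset.Iio k, minusFn Dp (f l) y :=
    Finset.prod_congr rfl fun l hl ↦ by
      rw [Finset.mem_Iio] at hl
      rw [if_pos hl]
  rw [h1, h2, if_neg (lt_irrefl k), if_pos rfl, vertexIntegrand]
  ring

/-- The vertex integrals converge. -/
theorem integrable_vertexIntegrand (ht : ContMDiff (𝓡 (n + 1)) 𝓘(ℝ, ℝ) ∞ t)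
    (hM : IsGloballyHyperbolic g t) (hGr : IsRetarded g t m Gr) (hGa : IsAdvanced g t m Ga)
    (hDp : IsTwoPoint g t m Gr Ga Dp) {N : ℕ} (hN : N ≠ 0) (hd : DispersionCondition g Dp N)
    {f : Fin N → M → ℂ} (hf : ∀ i, IsTest n (f i)) (k : Fin N) :
    Integrable (vertexIntegrand Gr Dp f k) (volumeMeasure g) := by
  have h : ∀ l ∈ (Finset.univ : Finset (Fin N)), MemLp (fun y ↦ if l < k then
      minusFn Dp (f l) y else if l = k then Gr (f l) y else Dp (f l) y) (N : ENNReal)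
        (volumeMeasure g) := by
    intro l _
    split_ifs
    · exact hd.memLp_minusFn hDp hN (hf l)
    · exact hd.memLp_retarded ht hM hGr hGa hDp hN (hf l)
    · exact hd.memLp hDp hN (hf l)
  -- Hölder: `N` factors in `L^N` have product in `L¹`, since the reciprocal exponents add up to
  -- one.
  have h1 := MemLp.prod' h
  rw [Finset.sum_const, Finset.card_univ, Fintype.card_fin, nsmul_eq_mul,
    ENNReal.mul_inv_cancel (by simpa using hN) (by simp), inv_one, memLp_one_iff_integrable] at h1
  exact h1.congr (Eventually.of_forall fun y ↦ (vertexIntegrand_eq_prod f k y).symm)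

end Distributions

section Wightman

variable {n : ℕ} {M : Type*} [TopologicalSpace M] [T2Space M] [SecondCountableTopology M]
  [Nonempty M] [ChartedSpace (Coord n) M] [IsManifold (𝓡 (n + 1)) ∞ M]
  [MeasurableSpace M] [BorelSpace M] {g : LorentzMetric n M} {t : M → ℝ} {m : ℝ}
  {Gr Ga Dp : (M → ℂ) → M → ℂ}

/-! ### Hermiticity -/

theorem prod_Iio_rev {N : ℕ} (k : Fin N) (F : Fin N → ℂ) :
    ∏ l ∈ Finset.Iio k.rev, F l.rev = ∏ l ∈ Finset.Ioi k, F l :=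
  Finset.prod_nbij' Fin.rev Fin.rev (by simp [Fin.lt_rev_iff]) (by simp [Fin.lt_rev_iff]) (by simp)
    (by simp) (by simp)

theorem prod_Ioi_rev {N : ℕ} (k : Fin N) (F : Fin N → ℂ) :
    ∏ l ∈ Finset.Ioi k.rev, F l.rev = ∏ l ∈ Finset.Iio k, F l :=
  Finset.prod_nbij' Fin.rev Fin.rev (by simp [Fin.rev_lt_iff]) (by simp) (by simp)
    (by simp) (by simp)

/-- `D⁻(f̄, ·)` is the conjugate of `D⁺(f, ·)`, and reversal moves the factors before the vertex
behind it. The middle factor is preserved because `G_r` is real. -/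
theorem conj_vertexIntegrand (hreal : ∀ f, IsTest n f → Gr (bar f) = bar (Gr f)) {N : ℕ}
    {f : Fin N → M → ℂ} (hf : ∀ i, IsTest n (f i)) (k : Fin N) (y : M) :
    starRingEnd ℂ (vertexIntegrand Gr Dp (fun i ↦ bar (f i.rev)) k.rev y) =
      vertexIntegrand Gr Dp f k y := by
  simp only [vertexIntegrand, map_mul, map_prod, minusFn, bar_bar, Fin.rev_rev, hreal _ (hf k)]
  rw [prod_Ioi_rev k fun l ↦ starRingEnd ℂ (Dp (bar (f l)) y)]
  have h : ∏ l ∈ Finset.Iio k.rev, starRingEnd ℂ (bar (Dp (f l.rev)) y) =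
      ∏ l ∈ Finset.Ioi k, Dp (f l) y := by
    rw [← prod_Iio_rev k fun l ↦ Dp (f l) y]
    simp [bar]
  rw [h]
  simp only [bar, Complex.conj_conj]
  ring

theorem hermitian_truncatedWightman (hGr : IsRetarded g t m Gr)
    (hDp : IsTwoPoint g t m Gr Ga Dp) (b : ℝ) (bn : ℕ → ℝ) :
    Hermitian n (truncatedWightman g m b bn Gr Dp) := by
  intro N f hf
  match N, f, hf with
  | 0, _, _ => simp [truncatedWightman]
  | 1, _, _ => simp [truncatedWightman]
  | 2, f, hf =>
    simp only [truncatedWightman, map_mul, Complex.conj_ofReal]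
    congr 1
    rw [← hDp.symmetric _ _ (hf 1) (hf 0), pair, pair, ← integral_conj]
    refine integral_congr_ae (Eventually.of_forall fun y ↦ ?_)
    change minusFn Dp (f 1) y * f 0 y = starRingEnd ℂ (Dp (bar (f 1)) y * bar (f 0) y)
    simp [minusFn, bar]
  | N + 3, f, hf =>
    simp only [truncatedWightman, map_mul, Complex.conj_ofReal, map_sum]
    congr 1
    rw [← Equiv.sum_comp Fin.revPerm fun k ↦ starRingEnd ℂ
      (∫ y, vertexIntegrand Gr Dp (fun i ↦ bar (f i.rev)) k y ∂(volumeMeasure g))]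
    refine Finset.sum_congr rfl fun k _ ↦ ?_
    rw [← integral_conj]
    exact integral_congr_ae (Eventually.of_forall fun y ↦
      (conj_vertexIntegrand hGr.real hf k y).symm)

/-! ### Invariance -/

theorem invariant_truncatedWightman (ht : ContMDiff (𝓡 (n + 1)) 𝓘(ℝ, ℝ) ∞ t)
    (hM : IsGloballyHyperbolic g t) (hGr : IsRetarded g t m Gr) (hGa : IsAdvanced g t m Ga)
    (hDp : IsTwoPoint g t m Gr Ga Dp) (b : ℝ) (bn : ℕ → ℝ) :
    Invariant g t (truncatedWightman g m b bn Gr Dp) := by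
  intro α hα N f hf
  match N, f, hf with
  | 0, _, _ => simp [truncatedWightman]
  | 1, _, _ => simp [truncatedWightman]
  | 2, f, hf => simp only [truncatedWightman, hDp.invariant α hα _ _ (hf 0) (hf 1)]
  | N + 3, f, hf =>
    simp only [truncatedWightman]
    congr 1
    refine Finset.sum_congr rfl fun k _ ↦ ?_
    -- After transport of the integration variable by `α⁻¹`, the integrands agree almost everywhere
    -- because each of the finitely many factors does.
    rw [← integral_comp_isometry hα (vertexIntegrand Gr Dp f k)]
    refine integral_congr_ae ?_
    have h1 := eventually_all.2 fun l ↦ hDp.apply_comp_ae hα (hf l)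
    have h2 := eventually_all.2 fun l ↦ hDp.minusFn_comp_ae hα (hf l)
    filter_upwards [h1, h2] with y hy1 hy2
    simp only [vertexIntegrand, hy1, hy2, retarded_comp ht hM hGr hGa hDp hα (hf k),
      Function.comp_apply]

/-! ### Locality -/

theorem retarded_mul_advanced_eq_zero (hGr : IsRetarded g t m Gr) (hGa : IsAdvanced g t m Ga)
    {f h : M → ℂ} (hf : IsTest n f) (hh : IsTest n h)
    (hsp : ∀ x ∈ tsupport f, ∀ y ∈ tsupport h, Spacelike g t x y) (y : M) :
    Gr f y * Ga h y = 0 := by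
  by_contra h0
  exact not_spacelike_of_causal hsp (hGr.mem_causalPast hf (left_ne_zero_of_mul h0))
    (hGa.mem_causalFuture hh (right_ne_zero_of_mul h0))

/-- On the support of `h` neither `G_r(f, ·)` nor `G_a(f, ·)` can be nonzero without a causal
relation to `supp f`. This gives locality of the two-point function. -/
theorem commutatorFn_mul_eq_zero (hGr : IsRetarded g t m Gr) (hGa : IsAdvanced g t m Ga)
    {f h : M → ℂ} (hf : IsTest n f)
    (hsp : ∀ x ∈ tsupport f, ∀ y ∈ tsupport h, Spacelike g t x y) (y : M) :
    commutatorFn Gr Ga f y * h y = 0 := by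
  by_contra h0
  have hy : y ∈ tsupport h := subset_tsupport _ (right_ne_zero_of_mul h0)
  have hc := left_ne_zero_of_mul h0
  by_cases hr : Gr f y = 0
  · have ha : Ga f y ≠ 0 := by
      intro ha
      simp [commutatorFn, hr, ha] at hc
    obtain ⟨x, hx, hxy⟩ := hGa.mem_causalFuture hf ha
    exact (hsp x hx y hy).1 hxy
  · obtain ⟨x, hx, hxy⟩ := hGr.mem_causalPast hf hr
    exact (hsp x hx y hy).2 hxy

/-! ### Exchange of two neighbouring arguments in a vertex integrand. -/

section Swap

variable {N : ℕ} {i j : Fin N} (f : Fin N → M → ℂ)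

theorem Iio_eq_insert_of_succ (hij : i.val + 1 = j.val) :
    Finset.Iio j = insert i (Finset.Iio i) := by
  ext l
  simp only [Finset.mem_Iio, Finset.mem_insert, Fin.lt_def, Fin.ext_iff]
  omega

theorem Ioi_eq_insert_of_succ (hij : i.val + 1 = j.val) :
    Finset.Ioi i = insert j (Finset.Ioi j) := by
  ext l
  simp only [Finset.mem_Ioi, Finset.mem_insert, Fin.lt_def, Fin.ext_iff]
  omega

/-- The prefactor is the one in `vertexIntegrand_right` and does not involve the arguments `i` and
`j`, so the exchange concerns the last bracket only. -/
theorem vertexIntegrand_left (hij : i.val + 1 = j.val) (y : M) :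
    vertexIntegrand Gr Dp f i y = (∏ l ∈ Finset.Iio i, minusFn Dp (f l) y) *
      (∏ l ∈ Finset.Ioi j, Dp (f l) y) * (Gr (f i) y * Dp (f j) y) := by
  rw [vertexIntegrand, Ioi_eq_insert_of_succ hij, Finset.prod_insert (by simp)]
  ring

theorem vertexIntegrand_right (hij : i.val + 1 = j.val) (y : M) :
    vertexIntegrand Gr Dp f j y = (∏ l ∈ Finset.Iio i, minusFn Dp (f l) y) *
      (∏ l ∈ Finset.Ioi j, Dp (f l) y) * (minusFn Dp (f i) y * Gr (f j) y) := by
  rw [vertexIntegrand, Iio_eq_insert_of_succ hij, Finset.prod_insert (by simp)]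
  ring

theorem prod_comp_swap {s : Finset (Fin N)} (hs : i ∈ s ↔ j ∈ s) (F : Fin N → ℂ) :
    ∏ l ∈ s, F (Equiv.swap i j l) = ∏ l ∈ s, F l := by
  refine Finset.prod_equiv (Equiv.swap i j) (fun l ↦ ?_) fun _ _ ↦ rfl
  rw [Equiv.swap_apply_def]
  split_ifs with h1 h2
  · rw [h1, hs]
  · rw [h2, hs]
  · rfl

/-- Both arguments lie on the same side of the vertex `k`, inside one commutative product. -/
theorem vertexIntegrand_swap_of_ne (hij : i.val + 1 = j.val) {k : Fin N} (hki : k ≠ i)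
    (hkj : k ≠ j) (y : M) :
    vertexIntegrand Gr Dp (f ∘ Equiv.swap i j) k y = vertexIntegrand Gr Dp f k y := by
  simp only [ne_eq, Fin.ext_iff] at hki hkj
  have h1 : i ∈ Finset.Iio k ↔ j ∈ Finset.Iio k := by
    simp only [Finset.mem_Iio, Fin.lt_def]
    omega
  have h2 : i ∈ Finset.Ioi k ↔ j ∈ Finset.Ioi k := by
    simp only [Finset.mem_Ioi, Fin.lt_def]
    omega
  simp only [vertexIntegrand, Function.comp_apply]
  rw [prod_comp_swap h1 fun l ↦ minusFn Dp (f l) y, prod_comp_swap h2 fun l ↦ Dp (f l) y,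
    Equiv.swap_apply_of_ne_of_ne (by simpa [Fin.ext_iff] using hki)
      (by simpa [Fin.ext_iff] using hkj)]

end Swap

/-- The contributions of two neighbouring fields with space-like separated arguments to the
commutator cancel. -/
theorem vertexIntegrand_add_swap_ae (hGr : IsRetarded g t m Gr) (hGa : IsAdvanced g t m Ga)
    (hDp : IsTwoPoint g t m Gr Ga Dp) {N : ℕ} {f : Fin N → M → ℂ} (hf : ∀ i, IsTest n (f i))
    {i j : Fin N} (hij : i.val + 1 = j.val)
    (hsp : ∀ x ∈ tsupport (f i), ∀ y ∈ tsupport (f j), Spacelike g t x y) :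
    (fun y ↦ vertexIntegrand Gr Dp f i y + vertexIntegrand Gr Dp f j y) =ᵐ[volumeMeasure g]
      fun y ↦ vertexIntegrand Gr Dp (f ∘ Equiv.swap i j) i y +
        vertexIntegrand Gr Dp (f ∘ Equiv.swap i j) j y := by
  filter_upwards [hDp.sub_minusFn_ae hGr hGa (hf i), hDp.sub_minusFn_ae hGr hGa (hf j)]
    with y hi hj
  have h1 : i ∈ Finset.Iio i ↔ j ∈ Finset.Iio i := by
    simp only [Finset.mem_Iio, Fin.lt_def]
    omega
  have h2 : i ∈ Finset.Ioi j ↔ j ∈ Finset.Ioi j := by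
    simp only [Finset.mem_Ioi, Fin.lt_def]
    omega
  rw [vertexIntegrand_left f hij, vertexIntegrand_right f hij, vertexIntegrand_left _ hij,
    vertexIntegrand_right _ hij]
  simp only [Function.comp_apply, Equiv.swap_apply_left, Equiv.swap_apply_right]
  rw [prod_comp_swap h1 fun l ↦ minusFn Dp (f l) y, prod_comp_swap h2 fun l ↦ Dp (f l) y]
  have h3 := retarded_mul_advanced_eq_zero hGr hGa (hf i) (hf j) hsp y
  have h4 := retarded_mul_advanced_eq_zero hGr hGa (hf j) (hf i)
    (fun x hx z hz ↦ (hsp z hz x hx).symm) y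
  rw [← mul_add, ← mul_add]
  congr 1
  -- Writing `R, A` for `G_r, G_a`, the difference of the brackets is `R_i (D⁺ - D⁻)_j - R_j (D⁺ -
  -- D⁻)_i = 2i (R_j A_i - R_i A_j)`: the terms `R_i R_j` cancel, and both remaining products
  -- vanish.
  linear_combination Gr (f i) y * hj - Gr (f j) y * hi - 2 * Complex.I * h3 + 2 * Complex.I * h4

theorem local_truncatedWightman (ht : ContMDiff (𝓡 (n + 1)) 𝓘(ℝ, ℝ) ∞ t)
    (hM : IsGloballyHyperbolic g t) (hGr : IsRetarded g t m Gr) (hGa : IsAdvanced g t m Ga)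
    (hDp : IsTwoPoint g t m Gr Ga Dp) (b : ℝ) (bn : ℕ → ℝ)
    (hdisp : ∀ N, 3 ≤ N → bn N ≠ 0 → DispersionCondition g Dp N) :
    Local g t (truncatedWightman g m b bn Gr Dp) := by
  intro N f hf i j hij hsp
  match N, f, hf, i, j, hij, hsp with
  | 0, _, _, _, _, _, _ => simp [truncatedWightman]
  | 1, _, _, _, _, _, _ => simp [truncatedWightman]
  | 2, f, hf, i, j, hij, hsp =>
    obtain rfl : i = 0 := by
      rw [Fin.ext_iff, Fin.val_zero]
      omega
    obtain rfl : j = 1 := by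
      rw [Fin.ext_iff, Fin.val_one, ← hij]
      rfl
    simp only [truncatedWightman, Function.comp_apply, Equiv.swap_apply_left,
      Equiv.swap_apply_right]
    rw [← mul_sub, ← hDp.symmetric _ _ (hf 0) (hf 1), hDp.imaginary _ _ (hf 0) (hf 1), pair]
    simp only [commutatorFn_mul_eq_zero hGr hGa (hf 0) hsp]
    simp
  | N + 3, f, hf, i, j, hij, hsp =>
    simp only [truncatedWightman]
    -- At an order with zero coupling no dispersion condition is available, but the prefactor
    -- annihilates the integrals whatever their values.
    by_cases hb : bn (N + 3) = 0
    · simp [hb]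
    have hd := hdisp (N + 3) (by omega) hb
    have hint (f : Fin (N + 3) → M → ℂ) (hf : ∀ i, IsTest n (f i)) (k) :=
      integrable_vertexIntegrand ht hM hGr hGa hDp (by omega) hd hf k
    have hne : i ≠ j := by
      rintro rfl
      omega
    -- The cancellation mixes the vertices `i` and `j`, so their integrals have to be combined,
    -- which requires integrability; the other vertices cancel one by one.
    rw [← mul_sub, ← Finset.sum_sub_distrib, Fintype.sum_eq_add i j hne]
    · have h := integral_congr_ae (vertexIntegrand_add_swap_ae hGr hGa hDp hf hij hsp)
      rw [integral_add (hint f hf i) (hint f hf j),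
        integral_add (hint (f ∘ Equiv.swap i j) (fun k ↦ hf _) i)
          (hint (f ∘ Equiv.swap i j) (fun k ↦ hf _) j)] at h
      convert mul_zero _
      linear_combination h
    · rintro k ⟨hki, hkj⟩
      rw [sub_eq_zero]
      exact integral_congr_ae (Eventually.of_forall fun y ↦
        (vertexIntegrand_swap_of_ne f hij hki hkj y).symm)

end Wightman

end CurvedQFT


/-! ### The theorem. -/

theorem theorem4p1 {n : ℕ}
    -- the space-time
    {M : Type*} [TopologicalSpace M] [T2Space M] [SecondCountableTopology M] [Nonempty M]
    [ChartedSpace (CurvedQFT.Coord n) M] [IsManifold (𝓡 (n + 1)) ∞ M]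
    [MeasurableSpace M] [BorelSpace M]
    {S : Type*} [TopologicalSpace S] [ChartedSpace (EuclideanSpace ℝ (Fin n)) S]
    [IsManifold (𝓡 n) ∞ S]
    (g : CurvedQFT.LorentzMetric n M)
    (Φ : M ≃ₘ^∞⟮𝓡 (n + 1), (𝓘(ℝ, ℝ)).prod (𝓡 n)⟯ (ℝ × S))
    (hM : CurvedQFT.IsGloballyHyperbolic g (CurvedQFT.timeOf Φ))
    -- the fundamental functions
    (m : ℝ) (hm : 0 < m) (Gr Ga Dp : (M → ℂ) → M → ℂ)
    (hGr : CurvedQFT.IsRetarded g (CurvedQFT.timeOf Φ) m Gr)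
    (hGa : CurvedQFT.IsAdvanced g (CurvedQFT.timeOf Φ) m Ga)
    (hDp : CurvedQFT.IsTwoPoint g (CurvedQFT.timeOf Φ) m Gr Ga Dp)
    -- the coupling constants
    (b : ℝ) (hb : 0 < b) (bn : ℕ → ℝ)
    -- the dispersion condition holds at every order `N ≥ 3` at which there is an interaction
    (hdisp : ∀ N, 3 ≤ N → bn N ≠ 0 → CurvedQFT.DispersionCondition g Dp N)
    (WT W : (N : ℕ) → (Fin N → M → ℂ) → ℂ)
    (hWT : WT = CurvedQFT.truncatedWightman g m b bn Gr Dp)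
    (hW : W = CurvedQFT.fromTruncated WT) :
    -- all integrals that define the Wightman functions converge
    (∀ N, 3 ≤ N → bn N ≠ 0 → ∀ f : Fin N → M → ℂ, (∀ i, CurvedQFT.IsTest n (f i)) → ∀ k,
      MeasureTheory.Integrable (CurvedQFT.vertexIntegrand Gr Dp f k)
        (CurvedQFT.volumeMeasure g)) ∧
    (CurvedQFT.Hermitian n WT ∧ CurvedQFT.Hermitian n W) ∧
    (CurvedQFT.Invariant g (CurvedQFT.timeOf Φ) WT ∧
      CurvedQFT.Invariant g (CurvedQFT.timeOf Φ) W) ∧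
    (CurvedQFT.Local g (CurvedQFT.timeOf Φ) WT ∧
      CurvedQFT.Local g (CurvedQFT.timeOf Φ) W) := by
  subst hWT hW
  have ht := CurvedQFT.contMDiff_timeOf Φ
  have hH := CurvedQFT.hermitian_truncatedWightman hGr hDp b bn
  have hI := CurvedQFT.invariant_truncatedWightman ht hM hGr hGa hDp b bn
  have hL := CurvedQFT.local_truncatedWightman ht hM hGr hGa hDp b bn hdisp
  refine ⟨fun N hN hb f hf k ↦ ?_, ⟨hH, hH.fromTruncated⟩, ⟨hI, hI.fromTruncated⟩,
    ⟨hL, hL.fromTruncated⟩⟩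
  exact CurvedQFT.integrable_vertexIntegrand ht hM hGr hGa hDp (by omega) (hdisp N hN hb) hf k
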